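/- Let $H$ and $U$ be real Hilbert spaces, let $A:D(A)\subset H\to H$ generate a strongly continuous semigroup of contractions on $H$, let $B\in\mathcal L(U,H)$ and $k>0$, and put $\|z\|_{D(A)}=\|z\|_H+\|Az\|_H$. Assume that the origin of $z'=(A-kBB^\star)z$ is globally exponentially stable: the semigroup generated by $A-kBB^\star$ (with domain $D(A)$) satisfies $\|e^{t(A-kBB^\star)}z_0\|_H\le Ce^{-\alpha t}\|z_0\|_H$ for all $z_0\in H$, $t\ge0$, with some constants $C,\alpha>0$. Let $S$ be a real Banach space, densely and continuously embedded in $U$, so that $S\subseteq U=U'\subseteq S'$, and for $u\in U$ let $\|u\|_{S'}=\sup\{\langle u,s\rangle_U : s\in S,\ \|s\|_S\le 1\}$. Let $\sigma:U\to S$ be such that - $\sigma$ is locally Lipschitz as a map from $U$ to $U$; - there are $C_1,C_2>0$ and a continuous non-decreasing $h:\mathbb R\to[0,\infty)$ with $h(0)>0$ such that $\|\sigma(s)-C_1s\|_{S'}\le C_2\,h(\|s\|_S)\,\langle\sigma(s),s\rangle_U$ for all $s\in S$. Let $A_\sigma(z)=Az-\sqrt k\,B\sigma(\sqrt k\,B^\star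 z)$ for $z\in D(A)$, and consider $z'=A_\sigma(z)$. A strong solution on an interval is an absolutely continuous function $z$ with $z(t)\in D(A)$ and $z'(t)=A_\sigma(z(t))$ for almost every $t$. 1. If $S=U$ (with equal norms), then there are a self-adjoint coercive $P\in\mathcal L(H)$ and constants $M,C>0$ such that $$\langle (A-kC_1BB^\star)z,Pz\rangle_H+\langle Pz,(A-kC_1BB^\star)z\rangle_H\le -C\|z\|_H^2\qquad(z\in D(A)),$$ and such that $$V(z)=\langle Pz,z\rangle_H+M\int_0^{\|z\|_H^2}\sqrt v\,h\big(\sqrt k\,\|B\|\sqrt v\big)\,dv$$ is a strict global Lyapunov function for $z'=A_\sigma(z)$. That is, $V$ is of class $C^1$ on $H$; there are continuous, strictly increasing, unbounded functions $\psi_1,\psi_2$ on $[0,\infty)$, vanishing at $0$, with $\psi_1(\|z\|_H)\le V(z)\le\psi_2(\|z\|_H)$ for all $z\in H$; $DV(z)[A_\sigma(z)]\le -C\|z\|_H^2$ for all $z\in D(A)$; and along every strong solution on an interval $[0,\tau]$ the function $V(z(\cdot))$ is absolutely continuous with $\frac{d}{dt}V(z(t))\le -C\|z(t)\|_H^2$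 for almost every $t$. 2. For general $S$ (in particular $S\ne U$), suppose in addition that $\sigma$ is monotone, i.e. $\langle\sigma(s_1)-\sigma(s_2),s_1-s_2\rangle_U\ge0$ for all $s_1,s_2\in U$, that $\sigma$ maps bounded subsets of $U$ to bounded subsets of $U$, and that there is a constant $c_S$ such that $B^\star z\in S$ and $\|B^\star z\|_S\le c_S\|z\|_{D(A)}$ for all $z\in D(A)$. Then the origin of $z'=A_\sigma(z)$ is semi-globally exponentially stable in $D(A)$: for every $z_0\in D(A)$ there is a unique strong solution $t\mapsto W_\sigma(t)z_0$ on $[0,\infty)$ with $W_\sigma(0)z_0=z_0$, and for every $r>0$ there are $K,\mu>0$ such that $\|W_\sigma(t)z_0\|_H\le Ke^{-\mu t}\|z_0\|_H$ for all $t\ge0$ and all $z_0\in D(A)$ with $\|z_0\|_{D(A)}\le r$. -/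

import Mathlib

open Set Filter Topology MeasureTheory
open scoped NNReal InnerProductSpace

namespace NonlinearDamping

noncomputable section

/-- `(T t)_{t ≥ 0}` is a strongly continuous semigroup of bounded operators on `H`
(only the values at `t ≥ 0` matter). -/
structure IsC0Semigroup {H : Type*} [NormedAddCommGroup H] [NormedSpace ℝ H]
    (T : ℝ → H →L[ℝ] H) : Prop where
  map_zero : T 0 = ContinuousLinearMap.id ℝ H
  map_add : ∀ s t : ℝ, 0 ≤ s → 0 ≤ t → T (s + t) = (T s).comp (T t)
  continuousOn : ∀ z : H, ContinuousOn (fun t => T t z) (Ici 0)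

/-- `A` is the infinitesimal generator of `T`: its domain consists of those `z` for which
`(T t z - z) / t` converges as `t ↓ 0`, and `A z` is the limit. -/
def IsGenerator {H : Type*} [NormedAddCommGroup H] [NormedSpace ℝ H]
    (T : ℝ → H →L[ℝ] H) (A : H →ₗ.[ℝ] H) : Prop :=
  ∀ z y : H, (z, y) ∈ A.graph ↔
    Tendsto (fun t : ℝ => t⁻¹ • (T t z - z)) (𝓝[>] 0) (𝓝 y)

/-- `A` generates a strongly continuous semigroup of contractions. -/
def GeneratesContractionSemigroup {H : Type*} [NormedAddCommGroup H] [NormedSpace ℝ H]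
    (A : H →ₗ.[ℝ] H) : Prop :=
  ∃ T : ℝ → H →L[ℝ] H, IsC0Semigroup T ∧ IsGenerator T A ∧ ∀ t : ℝ, 0 ≤ t → ‖T t‖ ≤ 1

/-- The origin of `z' = L z` is globally exponentially stable: `L` generates a strongly
continuous semigroup that decays exponentially, uniformly on bounded sets of initial data. -/
def GloballyExpStable {H : Type*} [NormedAddCommGroup H] [NormedSpace ℝ H]
    (L : H →ₗ.[ℝ] H) : Prop :=
  ∃ T : ℝ → H →L[ℝ] H, IsC0Semigroup T ∧ IsGenerator T L ∧
    ∃ C > 0, ∃ α > 0, ∀ (z₀ : H) (t : ℝ), 0 ≤ t →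
      ‖T t z₀‖ ≤ C * Real.exp (-α * t) * ‖z₀‖

/-- The graph norm `‖z‖_{D(A)} = ‖z‖ + ‖A z‖`. -/
def graphNorm {H : Type*} [NormedAddCommGroup H] [NormedSpace ℝ H]
    (A : H →ₗ.[ℝ] H) (z : A.domain) : ℝ :=
  ‖(z : H)‖ + ‖A z‖

section

variable {H : Type*} [NormedAddCommGroup H] [InnerProductSpace ℝ H] [CompleteSpace H]
  {U : Type*} [NormedAddCommGroup U] [InnerProductSpace ℝ U] [CompleteSpace U]
  {S : Type*} [NormedAddCommGroup S] [NormedSpace ℝ S]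

/-- The linear operator `A - k B B*`, with domain `D(A)`. -/
def linearClosedLoop (A : H →ₗ.[ℝ] H) (B : U →L[ℝ] H) (k : ℝ) : H →ₗ.[ℝ] H where
  domain := A.domain
  toFun := A.toFun -
    (k • (B.comp (ContinuousLinearMap.adjoint B)).toLinearMap).comp A.domain.subtype

/-- `S` is densely and continuously embedded in the Hilbert space `U` by `ι`, so that
`S ⊆ U = U' ⊆ S'` (the pairing of `S` with `U ⊆ S'` being the inner product of `U`). -/
structure IsRigging (ι : S →L[ℝ] U) : Prop where
  injective : Function.Injective ι
  dense : DenseRange ι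

/-- The norm `‖u‖_{S'}` of `u ∈ U` as the functional `s ↦ ⟨u, s⟩_U` on `S`. -/
def dualNorm (ι : S →L[ℝ] U) (u : U) : ℝ :=
  ‖(innerSL ℝ u).comp ι‖

/-- The admissible gain functions `h : ℝ → ℝ₊`. -/
structure IsGain (h : ℝ → ℝ) : Prop where
  continuous : Continuous h
  mono : Monotone h
  nonneg : ∀ x, 0 ≤ h x
  pos_zero : 0 < h 0

/-- `‖σ(s) - C₁ s‖_{S'} ≤ C₂ h(‖s‖_S) ⟨σ(s), s⟩_U`, for all `s` at which `‖s‖_S` makes sense,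
that is, for all `s ∈ S`. -/
def DampingInequality (ι : S →L[ℝ] U) (σ : U → S) (C₁ C₂ : ℝ) (h : ℝ → ℝ) : Prop :=
  ∀ s : S, dualNorm ι (ι (σ (ι s)) - C₁ • ι s) ≤ C₂ * h ‖s‖ * ⟪ι (σ (ι s)), ι s⟫_ℝ

/-- `⟨σ(s₁) - σ(s₂), s₁ - s₂⟩_U ≥ 0` for all `s₁, s₂ ∈ U`. -/
def MonotoneDamping (ι : S →L[ℝ] U) (σ : U → S) : Prop :=
  ∀ s₁ s₂ : U, 0 ≤ ⟪ι (σ s₁) - ι (σ s₂), s₁ - s₂⟫_ℝ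

/-- The nonlinear operator `A_σ z = A z - √k B σ(√k B* z)`, with domain `D(A)`. -/
def nonlinearClosedLoop (A : H →ₗ.[ℝ] H) (B : U →L[ℝ] H) (k : ℝ) (ι : S →L[ℝ] U) (σ : U → S)
    (z : A.domain) : H :=
  A z - √k • B (ι (σ (√k • ContinuousLinearMap.adjoint B (z : H))))

/-- `z` is a strong solution of `z' = F(z)` on `[0, τ]`, where `F` is a (nonlinear) operator with
domain `D`: it is absolutely continuous, and for almost every `t` it is differentiable at `t`
with `z(t) ∈ D` and `z'(t) = F(z(t))`. -/
structure IsStrongSolutionOn {D : Submodule ℝ H} (F : D → H) (τ : ℝ) (z : ℝ → H) : Prop where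
  absCont : AbsolutelyContinuousOnInterval z 0 τ
  ode : ∀ᵐ t : ℝ, t ∈ Ioo 0 τ → ∃ ht : z t ∈ D, HasDerivAt z (F ⟨z t, ht⟩) t

/-- Strong solution on `[0, ∞)` with initial value `z₀`. -/
structure IsStrongSolution {D : Submodule ℝ H} (F : D → H) (z₀ : H) (z : ℝ → H) : Prop where
  init : z 0 = z₀
  sol : ∀ τ > 0, IsStrongSolutionOn F τ z

/-- A comparison function of class `K∞`. -/
structure IsClassKInfty (ψ : ℝ → ℝ) : Prop where
  continuousOn : ContinuousOn ψ (Ici 0)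
  strictMonoOn : StrictMonoOn ψ (Ici 0)
  map_zero : ψ 0 = 0
  tendsto : Tendsto ψ atTop atTop

/-- `V : H → ℝ` is a strict global Lyapunov function for `z' = F(z)`: it is of class `C¹`,
positive definite and coercive, and it decreases at a rate at least `C ‖z‖²`, both
infinitesimally on the whole domain of `F` and along every strong solution. -/
structure IsStrictGlobalLyapunov {D : Submodule ℝ H} (F : D → H) (V : H → ℝ) (C : ℝ) :
    Prop where
  contDiff : ContDiff ℝ 1 V
  bounds : ∃ ψ₁ ψ₂ : ℝ → ℝ, IsClassKInfty ψ₁ ∧ IsClassKInfty ψ₂ ∧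
    ∀ z : H, ψ₁ ‖z‖ ≤ V z ∧ V z ≤ ψ₂ ‖z‖
  rate_pos : 0 < C
  dissipation : ∀ z : D, fderiv ℝ V (z : H) (F z) ≤ -C * ‖(z : H)‖ ^ 2
  along_solutions : ∀ (τ : ℝ) (z : ℝ → H), 0 < τ → IsStrongSolutionOn F τ z →
    AbsolutelyContinuousOnInterval (fun t => V (z t)) 0 τ ∧
    ∀ᵐ t : ℝ, t ∈ Ioo 0 τ →
      ∃ d : ℝ, HasDerivAt (fun s => V (z s)) d t ∧ d ≤ -C * ‖z t‖ ^ 2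

/-- The function `z ↦ ⟨P z, z⟩ + M ∫₀^{‖z‖²} √v h(b √v) dv`. -/
def lyapunovFunction (P : H →L[ℝ] H) (M : ℝ) (h : ℝ → ℝ) (b : ℝ) (z : H) : ℝ :=
  ⟪P z, z⟫_ℝ + M * ∫ v in (0 : ℝ)..(‖z‖ ^ 2), √v * h (b * √v)

/-- `W` is the flow of strong solutions of `z' = F(z)`: for every `z₀` in the domain of `F`,
`t ↦ W t z₀` is the unique strong solution on `[0, ∞)` issued from `z₀`. -/
def IsStrongFlow {D : Submodule ℝ H} (F : D → H) (W : ℝ → H → H) : Prop :=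
  ∀ z₀ : D, IsStrongSolution F z₀ (fun t => W t z₀) ∧
    ∀ z : ℝ → H, IsStrongSolution F z₀ z → ∀ t : ℝ, 0 ≤ t → z t = W t z₀

/-- The origin of `z' = F(z)`, with `F` defined on `D(A)`, is semi-globally exponentially stable
in `D(A)`: strong solutions exist uniquely, and on every ball of `D(A)` they decay exponentially
in `H` with constants that depend on the radius only. -/
def SemiGloballyExpStable (A : H →ₗ.[ℝ] H) (F : A.domain → H) : Prop :=
  ∃ W : ℝ → H → H, IsStrongFlow F W ∧
    ∀ r > 0, ∃ K > 0, ∃ μ > 0, ∀ z₀ : A.domain, graphNorm A z₀ ≤ r →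
      ∀ t : ℝ, 0 ≤ t → ‖W t z₀‖ ≤ K * Real.exp (-μ * t) * ‖(z₀ : H)‖

end

end

end NonlinearDamping

open NonlinearDamping

/-! Both parts rest on one accounting. Put s = √k B*z and θ = ⟨σ(s), s⟩. Since `A` is dissipative,
‖z‖² decreases at rate at least 2θ, and the damping inequality bounds the deviation σ(s) − C₁s from
a linear feedback by a multiple of the same θ. An error proportional to θ is therefore paid for by
adding a large enough multiple of an increasing function of ‖z‖².

When S = U, a finite-horizon Gramian of the stable linear semigroup, plus a multiple of the
identity, gives a quadratic form that decreases strictly along A − kC₁BB*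
(`exists_coercive_lyapunov_operator`). Along the nonlinear equation the error is at most of order
‖z‖ h(b‖z‖) θ with b = √k‖B‖, which is the weight produced by differentiating the integral term of V
(`exists_strictGlobalLyapunov`).

For general S the dual pairing costs an S-norm, which only the graph norm controls. The nonlinear
solution is compared directly with the orbit T(t)z(s) of the linear closed loop: on bounded sets of
D(A), ‖z(s+t) − T(t)z(s)‖² + c‖z(s+t)‖² is non-increasing in t (`exists_dissipation_constant`). Over
a time τ for which ‖T(τ)‖ ≤ 1/2, this forces ‖z‖ to shrink by a fixed factor, and iteration gives
exponential decay (`exists_exponential_decay`).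

Well-posedness treats the damping as a locally Lipschitz dissipative perturbation of `A`. Mild
solutions do not separate, so comparison with a time shift shows that they are Lipschitz in time
when issued from D(A). This excludes blow-up, keeps the graph norm bounded, and, by weak
compactness, keeps the solution in D(A) (`exists_strongSolution`). -/

namespace NonlinearDamping

/-! ### Contraction semigroups and their generators. -/

section Semigroup

variable {H : Type*} [NormedAddCommGroup H] [NormedSpace ℝ H]

/-- A strongly continuous semigroup of contractions, extended to negative times so that it is
jointly continuous on `ℝ × H`. -/
structure IsContractionSemigroup (T : ℝ → H →L[ℝ] H) : Prop where
  map_zero : T 0 = ContinuousLinearMap.id ℝ H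
  map_add : ∀ s t : ℝ, 0 ≤ s → 0 ≤ t → T (s + t) = (T s).comp (T t)
  norm_le : ∀ t, ‖T t‖ ≤ 1
  continuous_uncurry : Continuous fun p : ℝ × H => T p.1 p.2

theorem IsContractionSemigroup.norm_apply_le {T : ℝ → H →L[ℝ] H} (hT : IsContractionSemigroup T)
    (t : ℝ) (x : H) : ‖T t x‖ ≤ ‖x‖ := by
  simpa using (T t).le_of_opNorm_le (hT.norm_le t) x

theorem IsContractionSemigroup.continuous_apply {T : ℝ → H →L[ℝ] H}
    (hT : IsContractionSemigroup T) {X : Type*} [TopologicalSpace X] {a : X → ℝ} {f : X → H}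
    (ha : Continuous a) (hf : Continuous f) : Continuous fun x => T (a x) (f x) :=
  hT.continuous_uncurry.comp (ha.prodMk hf)

theorem IsGenerator.congr {T T' : ℝ → H →L[ℝ] H} {A : H →ₗ.[ℝ] H} (hA : IsGenerator T A)
    (hTT' : ∀ t, 0 ≤ t → T t = T' t) : IsGenerator T' A := by
  intro z y
  rw [hA z y]
  refine tendsto_congr' ?_
  filter_upwards [self_mem_nhdsWithin] with t ht
  rw [hTT' t (le_of_lt ht)]

/-- A contraction semigroup may be assumed to be jointly continuous on `ℝ × H`. -/
theorem GeneratesContractionSemigroup.exists_isContractionSemigroup {A : H →ₗ.[ℝ] H}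
    (hA : GeneratesContractionSemigroup A) :
    ∃ T : ℝ → H →L[ℝ] H, IsContractionSemigroup T ∧ IsGenerator T A := by
  obtain ⟨T, hT, hgen, hn⟩ := hA
  have hmax : ∀ t, 0 ≤ t → T t = T (max t 0) := fun t ht => by rw [max_eq_left ht]
  refine ⟨fun t => T (max t 0), ⟨by simpa using hT.map_zero, fun s t hs ht => ?_,
    fun t => hn _ (le_max_right _ _), ?_⟩, hgen.congr hmax⟩
  · simp only [← hmax _ hs, ← hmax _ ht, ← hmax _ (add_nonneg hs ht)]
    exact hT.map_add s t hs ht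
  -- Continuity in time for each vector, together with a Lipschitz bound in space uniform in time,
  -- gives joint continuity.
  · refine continuous_prod_of_continuous_lipschitzWith' _ 1 (fun t => ?_) fun z => ?_
    · have := (T (max t 0)).lipschitz
      exact this.weaken (by exact_mod_cast hn _ (le_max_right t 0))
    · have h := (hT.continuousOn z).comp_continuous (f := fun t : ℝ => max t 0) (by fun_prop)
        (fun t => le_max_right t 0)
      exact h

/-- The domain of a generator is invariant, and the semigroup commutes with its generator. -/
theorem IsGenerator.map_mem_graph {T : ℝ → H →L[ℝ] H} {A : H →ₗ.[ℝ] H} (hT : IsC0Semigroup T)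
    (hA : IsGenerator T A) {x y : H} (hxy : (x, y) ∈ A.graph) {t : ℝ} (ht : 0 ≤ t) :
    (T t x, T t y) ∈ A.graph := by
  rw [hA] at hxy ⊢
  refine (((T t).continuous.tendsto y).comp hxy).congr' ?_
  filter_upwards [self_mem_nhdsWithin] with h hh
  have h1 : T h (T t x) = T t (T h x) := by
    rw [← ContinuousLinearMap.comp_apply, ← hT.map_add h t (le_of_lt hh) ht, add_comm,
      hT.map_add t h ht (le_of_lt hh), ContinuousLinearMap.comp_apply]
  simp [h1]

theorem hasDerivWithinAt_Ici_iff_tendsto {f : ℝ → H} {f' : H} {t : ℝ} :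
    HasDerivWithinAt f f' (Ici t) t ↔
      Tendsto (fun h : ℝ => h⁻¹ • (f (t + h) - f t)) (𝓝[>] 0) (𝓝 f') := by
  rw [hasDerivWithinAt_iff_tendsto_slope, Ici_sdiff_left]
  have hmap : 𝓝[>] t = map (fun h => t + h) (𝓝[>] 0) := by
    simp
  rw [hmap, tendsto_map'_iff]
  refine tendsto_congr fun h => ?_
  simp [slope_def_module]

/-- Orbits starting in the domain of the generator are right differentiable. -/
theorem IsGenerator.hasDerivWithinAt_orbit {T : ℝ → H →L[ℝ] H} {A : H →ₗ.[ℝ] H}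
    (hT : IsC0Semigroup T) (hA : IsGenerator T A) {x y : H} (hxy : (x, y) ∈ A.graph) {t : ℝ}
    (ht : 0 ≤ t) : HasDerivWithinAt (fun s => T s x) (T t y) (Ici t) t := by
  rw [hasDerivWithinAt_Ici_iff_tendsto]
  have := (hA _ _).1 (hA.map_mem_graph hT hxy ht)
  refine this.congr' ?_
  filter_upwards [self_mem_nhdsWithin] with h hh
  rw [add_comm t h, hT.map_add h t (le_of_lt hh) ht, ContinuousLinearMap.comp_apply]

end Semigroup

section Averages

variable {E : Type*} [NormedAddCommGroup E] [NormedSpace ℝ E] [CompleteSpace E]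

/-- Averages over shrinking intervals of a continuous function of two variables. -/
theorem tendsto_average_intervalIntegral {φ : ℝ → ℝ → E} (hφ : Continuous (Function.uncurry φ)) :
    Tendsto (fun h : ℝ => h⁻¹ • ∫ s in (0 : ℝ)..h, φ h s) (𝓝[>] 0) (𝓝 (φ 0 0)) := by
  rw [Metric.tendsto_nhds]
  intro ε hε
  have h0 := (Metric.continuousAt_iff.1 (hφ.continuousAt (x := (0, 0)))) (ε / 2) (by positivity)
  obtain ⟨δ, hδ, hball⟩ := h0
  filter_upwards [Ioo_mem_nhdsGT hδ] with h hh
  have hh0 : 0 < h := hh.1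
  have hconst : φ 0 0 = h⁻¹ • ∫ s in (0 : ℝ)..h, φ 0 0 := by
    rw [intervalIntegral.integral_const, sub_zero, smul_smul, inv_mul_cancel₀ hh0.ne', one_smul]
  have hc : Continuous (fun s => φ h s) := hφ.comp (Continuous.prodMk_right h)
  rw [dist_eq_norm, hconst, ← smul_sub, ← intervalIntegral.integral_sub
    (hc.intervalIntegrable _ _) (continuous_const.intervalIntegrable _ _), norm_smul]
  have hb : ‖∫ s in (0 : ℝ)..h, (φ h s - φ 0 0)‖ ≤ ε / 2 * |h - 0| := by
    refine intervalIntegral.norm_integral_le_of_norm_le_const fun s hs => ?_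
    rw [uIoc_of_le hh0.le] at hs
    have : dist ((h, s) : ℝ × ℝ) (0, 0) < δ := by
      rw [Prod.dist_eq, max_lt_iff]
      simp only [Real.dist_eq, sub_zero]
      rw [abs_of_pos hh0, abs_of_pos hs.1]
      exact ⟨hh.2, hs.2.trans_lt hh.2⟩
    have := hball this
    rw [dist_eq_norm] at this
    exact this.le
  rw [sub_zero, abs_of_pos hh0] at hb
  rw [norm_inv, Real.norm_of_nonneg hh0.le]
  calc h⁻¹ * ‖∫ s in (0 : ℝ)..h, (φ h s - φ 0 0)‖ ≤ h⁻¹ * (ε / 2 * h) := by gcongr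
    _ = ε / 2 := by field_simp
    _ < ε := by linarith

end Averages

/-! ### Mild solutions: shift, concatenation, first-order expansion. -/

section Mild

variable {H : Type*} [NormedAddCommGroup H] [NormedSpace ℝ H]

/-- `z` is a mild solution on `[0, τ]` of `z' = A z + G(z)`, where `A` generates `T`. -/
structure IsMildSolution (T : ℝ → H →L[ℝ] H) (G : H → H) (τ : ℝ) (z : ℝ → H) : Prop where
  continuous : Continuous z
  eq : ∀ t ∈ Icc 0 τ, z t = T t (z 0) + ∫ s in (0 : ℝ)..t, T (t - s) (G (z s))

variable {T : ℝ → H →L[ℝ] H} {G : H → H} {τ : ℝ} {z w : ℝ → H}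

theorem IsMildSolution.mono (hz : IsMildSolution T G τ z) {τ' : ℝ} (h : τ' ≤ τ) :
    IsMildSolution T G τ' z :=
  ⟨hz.continuous, fun t ht => hz.eq t ⟨ht.1, ht.2.trans h⟩⟩

theorem IsContractionSemigroup.continuous_convolution_kernel (hT : IsContractionSemigroup T)
    {f : ℝ → H} (hf : Continuous f) :
    Continuous (Function.uncurry fun t s : ℝ => T (t - s) (f s)) :=
  hT.continuous_apply (by fun_prop) (by fun_prop)

theorem IsContractionSemigroup.continuous_convolution (hT : IsContractionSemigroup T)
    {f : ℝ → H} (hf : Continuous f) :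
    Continuous fun t : ℝ => ∫ s in (0 : ℝ)..t, T (t - s) (f s) :=
  intervalIntegral.continuous_parametric_intervalIntegral_of_continuous
    (hT.continuous_convolution_kernel hf) continuous_id

variable [CompleteSpace H]

/-- Splitting of the variation-of-constants integral. -/
theorem IsContractionSemigroup.convolution_add (hT : IsContractionSemigroup T)
    {f : ℝ → H} (hf : Continuous f) {a h : ℝ} (ha : 0 ≤ a) (hh : 0 ≤ h) :
    ∫ s in (0 : ℝ)..(a + h), T (a + h - s) (f s) =
      T h (∫ s in (0 : ℝ)..a, T (a - s) (f s)) + ∫ s in (0 : ℝ)..h, T (h - s) (f (a + s)) := by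
  have hc : ∀ t : ℝ, Continuous fun s : ℝ => T (t - s) (f s) := fun t =>
    hT.continuous_apply (by fun_prop) (by fun_prop)
  rw [← intervalIntegral.integral_add_adjacent_intervals (b := a)
    ((hc _).intervalIntegrable _ _) ((hc _).intervalIntegrable _ _)]
  congr 1
  · rw [← (T h).intervalIntegral_comp_comm ((hc a).intervalIntegrable _ _)]
    refine intervalIntegral.integral_congr fun s hs => ?_
    rw [uIcc_of_le ha] at hs
    have : a + h - s = h + (a - s) := by ring
    simp only [this, hT.map_add h (a - s) hh (by linarith [hs.2])]
    rfl
  · have := intervalIntegral.integral_comp_add_left (a := 0) (b := h)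
      (fun s => T (a + h - s) (f s)) a
    rw [add_zero] at this
    rw [← this]
    refine intervalIntegral.integral_congr fun s _ => ?_
    simp only [add_sub_add_left_eq_sub]

/-- Variation of constants restarted at time `a`; shifting, gluing and differentiating mild
solutions all reduce to it. -/
theorem IsMildSolution.step (hT : IsContractionSemigroup T) (hG : Continuous G)
    (hz : IsMildSolution T G τ z) {a h : ℝ} (ha : 0 ≤ a) (hh : 0 ≤ h) (hah : a + h ≤ τ) :
    z (a + h) = T h (z a) + ∫ s in (0 : ℝ)..h, T (h - s) (G (z (a + s))) := by
  rw [hz.eq (a + h) ⟨by positivity, hah⟩, hz.eq a ⟨ha, by linarith⟩,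
    hT.convolution_add (f := fun s => G (z s)) (hG.comp hz.continuous) ha hh, add_comm a h, hT.map_add h a hh ha]
  simp [add_assoc]

theorem IsMildSolution.shift (hT : IsContractionSemigroup T) (hG : Continuous G)
    (hz : IsMildSolution T G τ z) {a : ℝ} (ha : 0 ≤ a) :
    IsMildSolution T G (τ - a) fun t => z (a + t) := by
  refine ⟨hz.continuous.comp (by fun_prop), fun t ht => ?_⟩
  rw [add_zero]
  exact hz.step hT hG ha ht.1 (by linarith [ht.2])

theorem IsMildSolution.concat (hT : IsContractionSemigroup T) (hG : Continuous G) {δ : ℝ}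
    (hτ : 0 ≤ τ) (hz : IsMildSolution T G τ z) (hw : IsMildSolution T G δ w)
    (hzw : w 0 = z τ) :
    IsMildSolution T G (τ + δ) fun t => if t ≤ τ then z t else w (t - τ) := by
  have hcont : Continuous fun t => if t ≤ τ then z t else w (t - τ) := by
    refine hz.continuous.if_le (hw.continuous.comp (by fun_prop)) continuous_id
      continuous_const fun t ht => ?_
    simp [ht, hzw]
  have hleft : ∀ t, t ≤ τ → (if t ≤ τ then z t else w (t - τ)) = z t := fun t ht => if_pos ht
  have hright : ∀ t, τ ≤ t → (if t ≤ τ then z t else w (t - τ)) = w (t - τ) := by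
    intro t ht
    split_ifs with h
    · rw [le_antisymm h ht, sub_self, hzw]
    · rfl
  refine ⟨hcont, fun t ht => ?_⟩
  rw [hleft 0 hτ]
  rcases le_total t τ with htτ | htτ
  · rw [hleft t htτ, hz.eq t ⟨ht.1, htτ⟩]
    congr 1
    refine intervalIntegral.integral_congr fun s hs => ?_
    rw [uIcc_of_le ht.1] at hs
    simp only [hleft s (hs.2.trans htτ)]
  · obtain ⟨h, rfl⟩ : ∃ h, t = τ + h := ⟨t - τ, by ring⟩
    have hh : 0 ≤ h := by linarith
    rw [hright _ htτ, hT.convolution_add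
      (f := fun s => G (if s ≤ τ then z s else w (s - τ))) (hG.comp hcont) hτ hh, add_sub_cancel_left,
      hw.eq h ⟨hh, by linarith [ht.2]⟩, hzw, hz.eq τ ⟨hτ, le_rfl⟩, add_comm τ h,
      hT.map_add h τ hh hτ, map_add, add_assoc]
    congr 1
    congr 1
    · congr 1
      refine intervalIntegral.integral_congr fun s hs => ?_
      rw [uIcc_of_le hτ] at hs
      simp only [hleft s hs.2]
    · refine intervalIntegral.integral_congr fun s hs => ?_
      rw [uIcc_of_le hh] at hs
      have hs' := hright (τ + s) (by linarith [hs.1])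
      rw [add_sub_cancel_left] at hs'
      simp only [add_sub_cancel_left, hs']

/-- The first-order expansion `z(t + h) = T(h) z(t) + h ρ(h)` with `ρ(h) → G(z(t))`. -/
theorem IsMildSolution.exists_expansion (hT : IsContractionSemigroup T) (hG : Continuous G)
    (hz : IsMildSolution T G τ z) {t : ℝ} (ht : t ∈ Ico 0 τ) :
    ∃ ρ : ℝ → H, Tendsto ρ (𝓝[>] 0) (𝓝 (G (z t))) ∧
      ∀ᶠ h in 𝓝[>] (0 : ℝ), z (t + h) = T h (z t) + h • ρ h := by
  refine ⟨fun h => h⁻¹ • ∫ s in (0 : ℝ)..h, T (h - s) (G (z (t + s))), ?_, ?_⟩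
  · have hf : Continuous fun s => G (z (t + s)) := hG.comp (hz.continuous.comp (by fun_prop))
    simpa [hT.map_zero] using tendsto_average_intervalIntegral (hT.continuous_convolution_kernel hf)
  · filter_upwards [Ioo_mem_nhdsGT (sub_pos.2 ht.2)] with h hh
    rw [smul_smul, mul_inv_cancel₀ hh.1.ne', one_smul]
    exact hz.step hT hG ht.1 hh.1.le (by linarith [hh.2])

/-- A mild solution is right differentiable wherever it is in the domain of the generator. -/
theorem IsMildSolution.hasDerivWithinAt (hT : IsContractionSemigroup T) (hG : Continuous G)
    {A : H →ₗ.[ℝ] H} (hA : IsGenerator T A) (hz : IsMildSolution T G τ z) {t : ℝ}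
    (ht : t ∈ Ico 0 τ) {y : H} (hy : (z t, y) ∈ A.graph) :
    HasDerivWithinAt z (y + G (z t)) (Ici t) t := by
  obtain ⟨ρ, hρ, hex⟩ := hz.exists_expansion hT hG ht
  rw [hasDerivWithinAt_Ici_iff_tendsto]
  refine (((hA _ _).1 hy).add hρ).congr' ?_
  filter_upwards [hex, self_mem_nhdsWithin] with h hh hpos
  rw [hh, add_sub_right_comm, smul_add, smul_smul, inv_mul_cancel₀ (ne_of_gt hpos), one_smul]

end Mild

/-! ### Non-expansiveness and Lipschitz regularity of mild solutions. -/

section Dissipative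

variable {H : Type*} [NormedAddCommGroup H] [InnerProductSpace ℝ H]

/-- `G` is dissipative: `⟨G x - G y, x - y⟩ ≤ 0`. -/
def IsDissipative (G : H → H) : Prop :=
  ∀ x y : H, ⟪G x - G y, x - y⟫_ℝ ≤ 0

variable {T : ℝ → H →L[ℝ] H} {G : H → H} {τ : ℝ} {z w : ℝ → H}

theorem IsGenerator.inner_nonpos (hT : IsContractionSemigroup T) {A : H →ₗ.[ℝ] H}
    (hA : IsGenerator T A) {x y : H} (hxy : (x, y) ∈ A.graph) : ⟪y, x⟫_ℝ ≤ 0 := by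
  have h := ((hA x y).1 hxy).inner (𝕜 := ℝ) (tendsto_const_nhds (x := x))
  refine le_of_tendsto h ?_
  filter_upwards [self_mem_nhdsWithin] with t ht
  rw [real_inner_smul_left, inner_sub_left, real_inner_self_eq_norm_sq]
  have h1 := real_inner_le_norm (T t x) x
  have h2 := hT.norm_apply_le t x
  have h3 : ⟪T t x, x⟫_ℝ - ‖x‖ ^ 2 ≤ 0 := by nlinarith [norm_nonneg x]
  exact mul_nonpos_of_nonneg_of_nonpos (inv_nonneg.2 (le_of_lt ht)) h3

variable [CompleteSpace H]

/-- Mild solutions of a dissipative equation do not separate. -/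
theorem IsMildSolution.norm_sub_le (hT : IsContractionSemigroup T) (hG : Continuous G)
    (hdiss : IsDissipative G) (hz : IsMildSolution T G τ z) (hw : IsMildSolution T G τ w)
    {t : ℝ} (ht : t ∈ Icc 0 τ) : ‖z t - w t‖ ≤ ‖z 0 - w 0‖ := by
  have hcont : Continuous fun s => ‖z s - w s‖ ^ 2 :=
    ((hz.continuous.sub hw.continuous).norm).pow 2
  have key := image_le_of_liminf_slope_right_le_deriv_boundary
    (f := fun s => ‖z s - w s‖ ^ 2) (a := 0) (b := τ) hcont.continuousOn
    (B := fun _ => ‖z 0 - w 0‖ ^ 2) (B' := fun _ => 0) le_rfl continuousOn_const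
    (fun x _ => hasDerivWithinAt_const _ _ _) ?_ ht
  · exact (sq_le_sq₀ (norm_nonneg _) (norm_nonneg _)).1 key
  -- The solutions need not lie in the domain, so ‖z − w‖² may fail to be differentiable. Its right
  -- difference quotients can still be bounded: in the expansion the linear part contributes
  -- ‖T(h)d‖² ≤ ‖d‖², and the first-order remainder tends to 2⟨d, G z − G w⟩ ≤ 0.
  intro s hs r hr
  obtain ⟨ρ, hρ, hρz⟩ := hz.exists_expansion hT hG hs
  obtain ⟨π, hπ, hπw⟩ := hw.exists_expansion hT hG hs
  set d := z s - w s with hd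
  have hTd : Tendsto (fun h => T h d) (𝓝[>] 0) (𝓝 d) := by
    have : Continuous fun h => T h d := hT.continuous_apply continuous_id continuous_const
    simpa [hT.map_zero] using (this.tendsto 0).mono_left nhdsWithin_le_nhds
  have hlim : Tendsto (fun h : ℝ => 2 * ⟪T h d, ρ h - π h⟫_ℝ + h * ‖ρ h - π h‖ ^ 2) (𝓝[>] 0)
      (𝓝 (2 * ⟪d, G (z s) - G (w s)⟫_ℝ + 0 * ‖G (z s) - G (w s)‖ ^ 2)) :=
    ((hTd.inner (hρ.sub hπ)).const_mul 2).add
      ((tendsto_id.mono_left nhdsWithin_le_nhds).mul ((hρ.sub hπ).norm.pow 2))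
  have hneg : 2 * ⟪d, G (z s) - G (w s)⟫_ℝ + 0 * ‖G (z s) - G (w s)‖ ^ 2 < r := by
    have := hdiss (z s) (w s)
    rw [real_inner_comm] at this
    linarith
  have hev : ∀ᶠ h in 𝓝[>] (0 : ℝ), slope (fun s => ‖z s - w s‖ ^ 2) s (s + h) < r := by
    filter_upwards [hlim.eventually (gt_mem_nhds hneg), hρz, hπw, self_mem_nhdsWithin]
      with h h1 h2 h3 hpos
    have hpos' : (0 : ℝ) < h := hpos
    have hexp : z (s + h) - w (s + h) = T h d + h • (ρ h - π h) := by
      rw [h2, h3, hd, map_sub, smul_sub]; abel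
    have hsq : ‖z (s + h) - w (s + h)‖ ^ 2 =
        ‖T h d‖ ^ 2 + h * (2 * ⟪T h d, ρ h - π h⟫_ℝ + h * ‖ρ h - π h‖ ^ 2) := by
      rw [hexp, norm_add_sq_real, real_inner_smul_right, norm_smul, mul_pow, Real.norm_eq_abs,
        sq_abs]
      ring
    rw [slope_def_field, add_sub_cancel_left, div_lt_iff₀ hpos', hsq]
    have h4 : ‖T h d‖ ^ 2 ≤ ‖d‖ ^ 2 := by
      have := hT.norm_apply_le h d
      gcongr
    nlinarith
  have hmap : 𝓝[>] s = map (fun h => s + h) (𝓝[>] 0) := by simp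
  refine Eventually.frequently ?_
  rw [hmap]
  exact hev

/-- Mild solutions of a dissipative equation are determined by their initial value. -/
theorem IsMildSolution.eqOn (hT : IsContractionSemigroup T) (hG : Continuous G)
    (hdiss : IsDissipative G) (hz : IsMildSolution T G τ z) (hw : IsMildSolution T G τ w)
    (h0 : z 0 = w 0) : EqOn z w (Icc 0 τ) := by
  intro t ht
  have := hz.norm_sub_le hT hG hdiss hw ht
  rw [h0, sub_self, norm_zero] at this
  exact sub_eq_zero.1 (norm_le_zero_iff.1 this)

/-- Mild solutions starting in the domain of the generator are Lipschitz in time. -/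
theorem IsMildSolution.norm_sub_le_mul (hT : IsContractionSemigroup T) (hG : Continuous G)
    (hdiss : IsDissipative G) {A : H →ₗ.[ℝ] H} (hA : IsGenerator T A)
    (hz : IsMildSolution T G τ z) {y : H} (hy : (z 0, y) ∈ A.graph) {a h : ℝ} (ha : 0 ≤ a)
    (hh : 0 ≤ h) (hah : a + h ≤ τ) : ‖z (a + h) - z a‖ ≤ h * ‖y + G (z 0)‖ := by
  -- A time shift of `z` is again a mild solution, so its distance to `z` never exceeds the initial
  -- distance.
  have hshift : ∀ a h : ℝ, 0 ≤ a → 0 ≤ h → a + h ≤ τ → ‖z (a + h) - z a‖ ≤ ‖z h - z 0‖ := by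
    intro a h ha hh hah
    have h1 := (hz.shift hT hG hh).norm_sub_le hT hG hdiss (hz.mono (by linarith))
      (t := a) ⟨ha, by linarith⟩
    simpa [add_comm h a] using h1
  rcases hh.eq_or_lt with rfl | hpos
  · simp
  refine (hshift a h ha hh hah).trans ?_
  -- Cut `[0, h]` into equal steps: each increment is bounded by the first, and refining the
  -- partition turns the bound into `h` times the norm of the right derivative at 0.
  have hiter : ∀ (n : ℕ) (e : ℝ), 0 ≤ e → n * e ≤ τ → ‖z (n * e) - z 0‖ ≤ n * ‖z e - z 0‖ := by
    intro n e he
    induction n with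
    | zero => simp
    | succ n ih =>
      intro hle
      push_cast at hle ⊢
      have hn : (n : ℝ) * e ≤ τ := by nlinarith
      have h1 := hshift (n * e) e (by positivity) he (by linarith)
      have h2 := norm_sub_le_norm_sub_add_norm_sub (z (n * e + e)) (z (n * e)) (z 0)
      rw [show ((n : ℝ) + 1) * e = n * e + e by ring]
      linarith [ih hn]
  have hder := hz.hasDerivWithinAt hT hG hA ⟨le_rfl, by linarith⟩ hy
  rw [hasDerivWithinAt_Ici_iff_tendsto] at hder
  have hseq : Tendsto (fun n : ℕ => h / ((n : ℝ) + 1)) atTop (𝓝[>] 0) := by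
    refine tendsto_nhdsWithin_iff.2 ⟨?_, Eventually.of_forall fun n => ?_⟩
    · simpa [div_eq_mul_inv] using (tendsto_one_div_add_atTop_nhds_zero_nat (𝕜 := ℝ)).const_mul h
    · exact div_pos hpos (by positivity)
  have hlim := ((hder.comp hseq).norm).const_mul h
  refine ge_of_tendsto hlim (Eventually.of_forall fun n => ?_)
  have hn : (0 : ℝ) < (n : ℝ) + 1 := by positivity
  have he : (((n + 1 : ℕ) : ℝ)) * (h / ((n : ℝ) + 1)) = h := by push_cast; field_simp
  have h1 := hiter (n + 1) (h / ((n : ℝ) + 1)) (by positivity) (by rw [he]; linarith)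
  rw [he] at h1
  refine h1.trans (le_of_eq ?_)
  simp only [Function.comp_apply, zero_add, norm_smul, norm_inv, Real.norm_eq_abs]
  rw [abs_of_pos (by positivity)]
  push_cast
  field_simp

end Dissipative

/-! ### Membership in the domain from bounded difference quotients. -/

section WeakCompactness

variable {H : Type*} [NormedAddCommGroup H] [InnerProductSpace ℝ H]

variable {T : ℝ → H →L[ℝ] H}

/-- The operator `x ↦ ∫₀ᵗ T(s) x ds`. -/
theorem IsContractionSemigroup.exists_integral_clm (hT : IsContractionSemigroup T) (t : ℝ) :
    ∃ Q : H →L[ℝ] H, ∀ x, Q x = ∫ s in (0 : ℝ)..t, T s x := by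
  have hc : ∀ x : H, Continuous fun s => T s x := fun x =>
    hT.continuous_apply continuous_id continuous_const
  let Q : H →ₗ[ℝ] H :=
    { toFun := fun x => ∫ s in (0 : ℝ)..t, T s x
      map_add' := fun x y => by
        simp only [_root_.map_add]
        exact intervalIntegral.integral_add ((hc x).intervalIntegrable _ _)
          ((hc y).intervalIntegrable _ _)
      map_smul' := fun c x => by
        simp only [map_smul, RingHom.id_apply]
        exact intervalIntegral.integral_smul c _ }
  refine ⟨Q.mkContinuous |t| fun x => ?_, fun x => rfl⟩
  have := intervalIntegral.norm_integral_le_of_norm_le_const (a := 0) (b := t)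
    (f := fun s => T s x) (C := ‖x‖) (fun s _ => hT.norm_apply_le s x)
  rw [sub_zero, mul_comm] at this
  exact this

variable [CompleteSpace H]

/-- Bounded families in a Hilbert space have weak limit points. -/
theorem exists_weak_limit {X : Type*} {l : Filter X} [NeBot l] {a : X → H} {C : ℝ}
    (ha : ∀ᶠ x in l, ‖a x‖ ≤ C) :
    ∃ (u : Ultrafilter X) (y : H), ↑u ≤ l ∧
      ∀ e : H, Tendsto (fun x => ⟪a x, e⟫_ℝ) u (𝓝 ⟪y, e⟫_ℝ) := by
  let D := InnerProductSpace.toDual ℝ H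
  let u := Ultrafilter.of l
  have hu : ↑u ≤ l := Ultrafilter.of_le l
  let F : X → WeakDual ℝ H := fun x => StrongDual.toWeakDual (D (a x))
  have hcomp := WeakDual.isCompact_closedBall (𝕜 := ℝ) (E := H) 0 C
  have hmem : ∀ᶠ x in (u : Filter X), F x ∈ WeakDual.toStrongDual ⁻¹' Metric.closedBall 0 C := by
    filter_upwards [hu ha] with x hx
    simpa [F] using hx
  obtain ⟨f, -, hf⟩ := hcomp.ultrafilter_le_nhds (u.map F) (le_principal_iff.2 hmem)
  refine ⟨u, D.symm (WeakDual.toStrongDual f), hu, fun e => ?_⟩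
  have h1 : Tendsto F u (𝓝 f) := hf
  have h2 := (WeakDual.eval_continuous e).tendsto f |>.comp h1
  have h3 : ⟪D.symm (WeakDual.toStrongDual f), e⟫_ℝ = f e := by
    rw [InnerProductSpace.toDual_symm_apply]
    rfl
  rw [h3]
  exact h2

/-- In a Hilbert space, `x` is in the domain of the generator as soon as its difference quotients
are bounded. -/
theorem IsGenerator.exists_mem_graph_of_bounded (hT : IsContractionSemigroup T) {A : H →ₗ.[ℝ] H}
    (hA : IsGenerator T A) {x : H} {C : ℝ}
    (hx : ∀ᶠ h in 𝓝[>] (0 : ℝ), ‖h⁻¹ • (T h x - x)‖ ≤ C) : ∃ y, (x, y) ∈ A.graph := by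
  obtain ⟨u, y, hu, hy⟩ := exists_weak_limit hx
  have hc : ∀ x : H, Continuous fun s => T s x := fun x =>
    hT.continuous_apply continuous_id continuous_const
  refine ⟨y, ?_⟩
  -- Apply Q = ∫₀ᵗ T(s) ds to the difference quotients. The integrals telescope, so the images
  -- converge strongly to T(t)x − x; since Q is bounded, hence weakly continuous, they also converge
  -- weakly to Q y. Once this holds, averaging over `[0, t]` shows that the weak limit `y` is a
  -- strong derivative.
  have hint : ∀ t, 0 < t → T t x - x = ∫ s in (0 : ℝ)..t, T s y := by
    intro t ht
    obtain ⟨Q, hQ⟩ := hT.exists_integral_clm t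
    rw [← hQ]
    have hstrong : Tendsto (fun h : ℝ => Q (h⁻¹ • (T h x - x))) (𝓝[>] 0) (𝓝 (T t x - x)) := by
      have h1 := tendsto_average_intervalIntegral (φ := fun _ s => T (t + s) x)
        ((hc x).comp (by fun_prop))
      have h2 := tendsto_average_intervalIntegral (φ := fun _ s => T s x)
        ((hc x).comp (by fun_prop))
      simp only [add_zero, hT.map_zero, ContinuousLinearMap.id_apply] at h1 h2
      refine (h1.sub h2).congr' ?_
      filter_upwards [self_mem_nhdsWithin] with h hh
      have hh' : (0 : ℝ) < h := hh
      rw [← smul_sub, map_smul, hQ]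
      congr 1
      have e1 : ∫ s in (0 : ℝ)..t, T s (T h x - x) =
          (∫ s in (0 : ℝ)..t, T (s + h) x) - ∫ s in (0 : ℝ)..t, T s x := by
        rw [← intervalIntegral.integral_sub
          (f := fun s => T (s + h) x)
          (((hc x).comp (continuous_add_const h)).intervalIntegrable _ _)
          ((hc x).intervalIntegrable _ _)]
        refine intervalIntegral.integral_congr fun s hs => ?_
        rw [uIcc_of_le ht.le] at hs
        simp [hT.map_add s h hs.1 hh'.le]
      have e2 := intervalIntegral.integral_comp_add_right (a := 0) (b := t) (fun s => T s x) h
      have e3 := intervalIntegral.integral_comp_add_left (a := 0) (b := h) (fun s => T s x) t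
      have hi : ∀ a b : ℝ, IntervalIntegrable (fun s => T s x) volume a b := fun a b =>
        (hc x).intervalIntegrable _ _
      have e4 := intervalIntegral.integral_add_adjacent_intervals (hi 0 h) (hi h (t + h))
      have e5 := intervalIntegral.integral_add_adjacent_intervals (hi 0 t) (hi t (t + h))
      rw [zero_add] at e2
      rw [add_zero] at e3
      rw [e1, e2, e3, sub_eq_sub_iff_add_eq_add,
        add_comm (∫ s in t..t + h, T s x), e5, add_comm (∫ s in h..t + h, T s x), e4]
    refine ext_inner_right ℝ fun e => ?_
    have hw := hy (Q.adjoint e)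
    simp only [ContinuousLinearMap.adjoint_inner_right] at hw
    exact tendsto_nhds_unique ((hstrong.mono_left hu).inner tendsto_const_nhds) hw
  rw [hA]
  have h1 := tendsto_average_intervalIntegral (φ := fun _ s => T s y)
    ((hc y).comp (by fun_prop))
  simp only [hT.map_zero, ContinuousLinearMap.id_apply] at h1
  refine h1.congr' ?_
  filter_upwards [self_mem_nhdsWithin] with t ht
  rw [hint t ht]

end WeakCompactness

/-! ### Local mild solutions by Picard iteration. -/

section LocalExistence

variable {H : Type*} [NormedAddCommGroup H] [NormedSpace ℝ H] [CompleteSpace H]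
  {T : ℝ → H →L[ℝ] H} {G : H → H}

theorem exists_isMildSolution_of_locallyLipschitz (hT : IsContractionSemigroup T)
    (hG : LocallyLipschitz G) (x : H) :
    ∃ δ > 0, ∃ z : ℝ → H, z 0 = x ∧ IsMildSolution T G δ z := by
  obtain ⟨K, s, hs, hK⟩ := hG x
  obtain ⟨ρ, hρ, hρs⟩ := Metric.nhds_basis_closedBall.mem_iff.1 hs
  replace hK := hK.mono hρs
  have hTx : Continuous fun t => T t x := hT.continuous_apply continuous_id continuous_const
  obtain ⟨δ₁, hδ₁, hball⟩ := Metric.continuousAt_iff.1 (hTx.continuousAt (x := 0)) (ρ / 2)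
    (by positivity)
  set N : ℝ := ‖G x‖ + K * ρ with hN
  have hN0 : 0 ≤ N := by positivity
  -- The first bound keeps T(t)x within ρ/2 of x, the second makes the Picard map a 1/2-contraction,
  -- and the third keeps the integral term below ρ/2, `N` being a bound for ‖G‖ on the ball.
  set δ : ℝ := min (δ₁ / 2) (min (1 / (2 * (K + 1))) (ρ / (2 * (N + 1)))) with hδdef
  have hδ : 0 < δ := by
    refine lt_min (by positivity) (lt_min (by positivity) (by positivity))
  have hδT : ∀ t ∈ Icc 0 δ, ‖T t x - x‖ ≤ ρ / 2 := by
    intro t ht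
    have h1 : dist t 0 < δ₁ := by
      rw [Real.dist_eq, sub_zero, abs_of_nonneg ht.1]
      have := ht.2.trans (min_le_left _ _)
      linarith
    have h2 := hball h1
    rw [hT.map_zero, dist_eq_norm] at h2
    exact h2.le
  have hδK : K * δ ≤ 1 / 2 := by
    have h1 : δ ≤ 1 / (2 * (K + 1)) := (min_le_right _ _).trans (min_le_left _ _)
    rw [le_div_iff₀ (by positivity)] at h1
    nlinarith [K.coe_nonneg]
  have hδN : N * δ ≤ ρ / 2 := by
    have h1 : δ ≤ ρ / (2 * (N + 1)) := (min_le_right _ _).trans (min_le_right _ _)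
    rw [le_div_iff₀ (by positivity)] at h1
    nlinarith
  have hext : ∀ u : C(Icc 0 δ, H), Continuous (IccExtend hδ.le u) := fun u =>
    u.continuous.Icc_extend'
  have hkernel : ∀ u : C(Icc 0 δ, H),
      Continuous fun t : ℝ => ∫ s in (0 : ℝ)..t, T (t - s) (G (IccExtend hδ.le u s)) := fun u =>
    hT.continuous_convolution (hG.continuous.comp (hext u))
  -- Functions are extended by their endpoint values outside `[0, δ]`, so integrands are continuous
  -- on ℝ and membership in the ball persists at every real time.
  let Φ : C(Icc 0 δ, H) → C(Icc 0 δ, H) := fun u =>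
    ⟨fun t => T t x + ∫ s in (0 : ℝ)..t, T (t - s) (G (IccExtend hδ.le u s)),
      (hTx.add (hkernel u)).comp continuous_subtype_val⟩
  let S : Set C(Icc 0 δ, H) := {u | ∀ t, u t ∈ Metric.closedBall x ρ}
  have hSclosed : IsClosed S := by
    have : S = ⋂ t, (fun u : C(Icc 0 δ, H) => u t) ⁻¹' Metric.closedBall x ρ := by
      ext u; simp [S]
    rw [this]
    exact isClosed_iInter fun t => Metric.isClosed_closedBall.preimage (by fun_prop)
  have hmaps : MapsTo Φ S S := by
    intro u hu t
    have hb : ‖∫ s in (0 : ℝ)..t, T (t - s) (G (IccExtend hδ.le u s))‖ ≤ N * |(t : ℝ) - 0| := by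
      refine intervalIntegral.norm_integral_le_of_norm_le_const fun s _ => ?_
      refine (hT.norm_apply_le _ _).trans ?_
      have h1 : IccExtend hδ.le u s ∈ Metric.closedBall x ρ := hu _
      have h2 := hK.dist_le_mul _ h1 x (Metric.mem_closedBall_self hρ.le)
      rw [dist_eq_norm] at h2
      have h3 := norm_le_norm_add_norm_sub' (G (IccExtend hδ.le u s)) (G x)
      have h4 : (K : ℝ) * dist (IccExtend hδ.le u s) x ≤ K * ρ := by
        gcongr
        exact h1
      linarith
    rw [sub_zero, abs_of_nonneg t.2.1] at hb
    have h5 : N * (t : ℝ) ≤ N * δ := by gcongr; exact t.2.2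
    rw [Metric.mem_closedBall, dist_eq_norm]
    change ‖T t x + (∫ s in (0 : ℝ)..t, T (t - s) (G (IccExtend hδ.le u s))) - x‖ ≤ ρ
    rw [add_sub_right_comm]
    refine (norm_add_le _ _).trans ?_
    linarith [hδT t t.2]
  have hcontr : ContractingWith (1 / 2) (hmaps.restrict Φ S S) := by
    refine ⟨by rw [← NNReal.coe_lt_coe]; norm_num, LipschitzWith.of_dist_le_mul ?_⟩
    rintro ⟨u, hu⟩ ⟨v, hv⟩
    change dist (Φ u) (Φ v) ≤ _ * dist u v
    rw [ContinuousMap.dist_le (by positivity)]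
    intro t
    change dist (T t x + ∫ s in (0 : ℝ)..t, T (t - s) (G (IccExtend hδ.le u s)))
      (T t x + ∫ s in (0 : ℝ)..t, T (t - s) (G (IccExtend hδ.le v s))) ≤ _
    have hi : ∀ u : C(Icc 0 δ, H), IntervalIntegrable
        (fun s => T (t - s) (G (IccExtend hδ.le u s))) volume 0 t := fun u =>
      (hT.continuous_apply (by fun_prop) (hG.continuous.comp (hext u))).intervalIntegrable _ _
    rw [dist_add_left, dist_eq_norm, ← intervalIntegral.integral_sub (hi u) (hi v)]
    have hb : ‖∫ s in (0 : ℝ)..t, (T (t - s) (G (IccExtend hδ.le u s)) -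
        T (t - s) (G (IccExtend hδ.le v s)))‖ ≤ (K * dist u v) * |(t : ℝ) - 0| := by
      refine intervalIntegral.norm_integral_le_of_norm_le_const fun s _ => ?_
      rw [← map_sub]
      refine (hT.norm_apply_le _ _).trans ?_
      rw [← dist_eq_norm]
      refine (hK.dist_le_mul _ (hu _) _ (hv _)).trans ?_
      gcongr
      exact ContinuousMap.dist_apply_le_dist _
    rw [sub_zero, abs_of_nonneg t.2.1] at hb
    have ht : (t : ℝ) ≤ δ := t.2.2
    have hd : 0 ≤ dist u v := dist_nonneg
    refine hb.trans ?_
    calc K * dist u v * t ≤ K * dist u v * δ := by gcongr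
      _ = K * δ * dist u v := by ring
      _ ≤ 1 / 2 * dist u v := by gcongr
      _ = _ := by norm_num
  have hxS : ContinuousMap.const (Icc 0 δ) x ∈ S := fun t => Metric.mem_closedBall_self hρ.le
  obtain ⟨u, -, hu, -⟩ := hcontr.exists_fixedPoint' hSclosed.isComplete hmaps hxS (edist_ne_top _ _)
  have hu' : ∀ t (ht : t ∈ Icc 0 δ), IccExtend hδ.le u t =
      T t x + ∫ s in (0 : ℝ)..t, T (t - s) (G (IccExtend hδ.le u s)) := by
    intro t ht
    rw [IccExtend_of_mem hδ.le u ht]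
    exact (DFunLike.congr_fun hu ⟨t, ht⟩).symm
  have h0 : IccExtend hδ.le u 0 = x := by
    rw [hu' 0 ⟨le_rfl, hδ.le⟩]
    simp [hT.map_zero]
  refine ⟨δ, hδ, IccExtend hδ.le u, h0, hext u, fun t ht => ?_⟩
  rw [h0]
  exact hu' t ht

end LocalExistence

/-! ### Global mild solutions issued from the domain. -/

section GlobalExistence

/-- Completeness supplies a limit at the missing endpoint; extending to all of ℝ matches the
convention that mild solutions are continuous on the whole line. -/
theorem exists_continuous_eqOn_Ico {E : Type*} [NormedAddCommGroup E] [CompleteSpace E]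
    {f : ℝ → E} {a b : ℝ} (hab : a < b) (hf : UniformContinuousOn f (Ico a b)) :
    ∃ g : ℝ → E, Continuous g ∧ EqOn g f (Ico a b) := by
  have hlim : ∀ x ∈ Icc a b, ∃ y, Tendsto f (𝓝[Ico a b] x) (𝓝 y) := by
    intro x hx
    have hne : NeBot (𝓝[Ico a b] x) := by
      rw [← mem_closure_iff_nhdsWithin_neBot, closure_Ico hab.ne]
      exact hx
    have hc : Cauchy (𝓝[Ico a b] x) := cauchy_nhds.mono nhdsWithin_le_nhds
    exact CompleteSpace.complete (Cauchy.map_of_le hc hf inf_le_right)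
  have hcont : ContinuousOn (extendFrom (Ico a b) f) (Icc a b) :=
    continuousOn_extendFrom (by rw [closure_Ico hab.ne]) hlim
  refine ⟨IccExtend hab.le ((Icc a b).domRestrict (extendFrom (Ico a b) f)),
    hcont.domRestrict.Icc_extend', fun x hx => ?_⟩
  rw [IccExtend_of_mem hab.le _ (Ico_subset_Icc_self hx)]
  exact extendFrom_eq (subset_closure hx) (hf.continuousOn x hx)

variable {H : Type*} [NormedAddCommGroup H] [InnerProductSpace ℝ H] [CompleteSpace H]
  {T : ℝ → H →L[ℝ] H} {G : H → H}

/-- Mild solutions with the same initial value on a family of intervals can be glued. -/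
theorem exists_glued_mildSolution (hT : IsContractionSemigroup T) (hG : Continuous G)
    (hdiss : IsDissipative G) {x : H} {J : Set ℝ}
    (hJ : ∀ τ ∈ J, ∃ z : ℝ → H, z 0 = x ∧ IsMildSolution T G τ z)
    (hJord : ∀ τ ∈ J, Icc 0 τ ⊆ J) :
    ∃ u : ℝ → H, ∀ τ ∈ J, ∃ z : ℝ → H, z 0 = x ∧ IsMildSolution T G τ z ∧ EqOn u z (Icc 0 τ) := by
  choose! Z hZ0 hZ using hJ
  refine ⟨fun t => Z t t, fun τ hτ => ⟨Z τ, hZ0 τ hτ, hZ τ hτ, fun t ht => ?_⟩⟩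
  have htJ := hJord τ hτ ht
  exact (hZ t htJ).eqOn hT hG hdiss ((hZ τ hτ).mono ht.2) ((hZ0 t htJ).trans (hZ0 τ hτ).symm)
    ⟨ht.1, le_rfl⟩

theorem lipschitzOnWith_of_glued (hT : IsContractionSemigroup T) (hG : Continuous G)
    (hdiss : IsDissipative G) {A : H →ₗ.[ℝ] H} (hA : IsGenerator T A) {x y : H}
    (hxy : (x, y) ∈ A.graph) {J : Set ℝ} (hJ0 : ∀ τ ∈ J, 0 ≤ τ) {u : ℝ → H}
    (hu : ∀ τ ∈ J, ∃ z : ℝ → H, z 0 = x ∧ IsMildSolution T G τ z ∧ EqOn u z (Icc 0 τ)) :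
    LipschitzOnWith ‖y + G x‖₊ u J := by
  have key : ∀ a ∈ J, ∀ b ∈ J, a ≤ b → dist (u a) (u b) ≤ ‖y + G x‖ * dist a b := by
    intro a ha b hb hab
    obtain ⟨z, hz0, hz, huz⟩ := hu b hb
    have h1 := hz.norm_sub_le_mul hT hG hdiss hA (y := y) (by rwa [hz0]) (hJ0 a ha)
      (sub_nonneg.2 hab) (by linarith)
    rw [add_sub_cancel, hz0] at h1
    rw [huz ⟨hJ0 a ha, hab⟩, huz ⟨hJ0 b hb, le_rfl⟩, dist_comm, dist_eq_norm, dist_comm,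
      Real.dist_eq, abs_of_nonneg (sub_nonneg.2 hab)]
    linarith
  refine LipschitzOnWith.of_dist_le_mul fun a ha b hb => ?_
  rcases le_total a b with hab | hab
  · exact key a ha b hb hab
  · rw [dist_comm, dist_comm a b]
    exact key b hb a ha hab

/-- This is where blow-up is excluded. The Lipschitz constant ‖y + G x‖ does not depend on the
interval, so the solution extends to the endpoint, and the integral equation passes to the closure.
-/
theorem exists_isMildSolution_closed (hT : IsContractionSemigroup T) (hG : Continuous G)
    (hdiss : IsDissipative G) {A : H →ₗ.[ℝ] H} (hA : IsGenerator T A) {x y : H}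
    (hxy : (x, y) ∈ A.graph) {τ : ℝ} (hτ : 0 < τ)
    (hE : ∀ t ∈ Ico 0 τ, ∃ z : ℝ → H, z 0 = x ∧ IsMildSolution T G t z) :
    ∃ z : ℝ → H, z 0 = x ∧ IsMildSolution T G τ z := by
  obtain ⟨u, hu⟩ := exists_glued_mildSolution hT hG hdiss hE
    fun t ht s hs => ⟨hs.1, hs.2.trans_lt ht.2⟩
  have hlip := lipschitzOnWith_of_glued hT hG hdiss hA hxy (fun t ht => ht.1) hu
  obtain ⟨v, hv, hvu⟩ := exists_continuous_eqOn_Ico hτ hlip.uniformContinuousOn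
  have hv0 : v 0 = x := by
    obtain ⟨z, hz0, -, hz⟩ := hu 0 ⟨le_rfl, hτ⟩
    rw [hvu ⟨le_rfl, hτ⟩, hz ⟨le_rfl, le_rfl⟩, hz0]
  refine ⟨v, hv0, hv, ?_⟩
  have heq : EqOn v (fun t => T t (v 0) + ∫ s in (0 : ℝ)..t, T (t - s) (G (v s))) (Ico 0 τ) := by
    intro t ht
    obtain ⟨z, hz0, hz, huz⟩ := hu t ht
    have hvz : EqOn v z (Icc 0 t) := fun s hs => by
      rw [hvu ⟨hs.1, hs.2.trans_lt ht.2⟩, huz hs]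
    rw [hvz ⟨ht.1, le_rfl⟩, hz.eq t ⟨ht.1, le_rfl⟩]
    simp only [hv0, hz0]
    congr 1
    refine intervalIntegral.integral_congr fun s hs => ?_
    rw [uIcc_of_le ht.1] at hs
    simp only [hvz hs]
  have hcl := heq.closure hv ((hT.continuous_apply continuous_id continuous_const).add
    (hT.continuous_convolution (hG.comp hv)))
  rw [closure_Ico hτ.ne] at hcl
  exact hcl

/-- Global existence of mild solutions issued from the domain of the generator. -/
theorem exists_global_mildSolution (hT : IsContractionSemigroup T) (hG : LocallyLipschitz G)
    (hdiss : IsDissipative G) {A : H →ₗ.[ℝ] H} (hA : IsGenerator T A) {x y : H}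
    (hxy : (x, y) ∈ A.graph) :
    ∃ z : ℝ → H, z 0 = x ∧ LipschitzOnWith ‖y + G x‖₊ z (Ici 0) ∧
      ∀ τ, IsMildSolution T G τ z := by
  have hGc := hG.continuous
  -- `E` is an interval containing 0. If it were bounded it would contain its supremum, by the
  -- closure lemma, and could then be prolonged beyond it.
  let E : Set ℝ := {τ | 0 ≤ τ ∧ ∃ z : ℝ → H, z 0 = x ∧ IsMildSolution T G τ z}
  have hdown : ∀ τ ∈ E, Icc 0 τ ⊆ E := by
    rintro τ ⟨-, z, hz0, hz⟩ t ht
    exact ⟨ht.1, z, hz0, hz.mono ht.2⟩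
  have hext : ∀ τ ∈ E, ∃ δ > 0, τ + δ ∈ E := by
    rintro τ ⟨hτ, z, hz0, hz⟩
    obtain ⟨δ, hδ, w, hw0, hw⟩ := exists_isMildSolution_of_locallyLipschitz hT hG (z τ)
    exact ⟨δ, hδ, by linarith, _, by simp [hτ, hz0], hz.concat hT hGc hτ hw hw0⟩
  have h0E : (0 : ℝ) ∈ E := by
    obtain ⟨δ, hδ, w, hw0, hw⟩ := exists_isMildSolution_of_locallyLipschitz hT hG x
    exact ⟨le_rfl, w, hw0, hw.mono hδ.le⟩
  have hunb : ¬ BddAbove E := by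
    intro hbdd
    obtain ⟨δ, hδ, hδE⟩ := hext 0 h0E
    have hpos : 0 < sSup E := by
      have := le_csSup hbdd hδE
      linarith
    have hlt : ∀ t ∈ Ico 0 (sSup E), ∃ z : ℝ → H, z 0 = x ∧ IsMildSolution T G t z := by
      intro t ht
      obtain ⟨τ, hτ, htτ⟩ := exists_lt_of_lt_csSup ⟨0, h0E⟩ ht.2
      exact (hdown τ hτ ⟨ht.1, htτ.le⟩).2
    obtain ⟨ε, hε, hεE⟩ := hext (sSup E)
      ⟨hpos.le, exists_isMildSolution_closed hT hGc hdiss hA hxy hpos hlt⟩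
    have := le_csSup hbdd hεE
    linarith
  have hall : ∀ t ∈ Ici (0 : ℝ), ∃ z : ℝ → H, z 0 = x ∧ IsMildSolution T G t z := by
    intro t ht
    obtain ⟨τ, hτ, htτ⟩ := not_bddAbove_iff.1 hunb t
    exact (hdown τ hτ ⟨ht, htτ.le⟩).2
  obtain ⟨u, hu⟩ := exists_glued_mildSolution hT hGc hdiss hall fun t _ s hs => hs.1
  have hlip := lipschitzOnWith_of_glued hT hGc hdiss hA hxy (J := Ici 0) (fun t ht => ht) hu
  have heq : EqOn (fun t => u (max t 0)) u (Ici 0) := fun t ht => by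
    simp only [max_eq_left (mem_Ici.1 ht)]
  have hcont : Continuous fun t => u (max t 0) :=
    hlip.continuousOn.comp_continuous (by fun_prop) fun t => le_max_right t 0
  have hz0 : u (max 0 0) = x := by
    obtain ⟨z, hz0, -, hz⟩ := hu 0 self_mem_Ici
    rw [max_self, hz ⟨le_rfl, le_rfl⟩, hz0]
  refine ⟨fun t => u (max t 0), hz0, ?_, fun τ => ⟨hcont, fun t ht => ?_⟩⟩
  · intro a ha b hb
    rw [heq ha, heq hb]
    exact hlip ha hb
  · obtain ⟨z, hz0', hz, huz⟩ := hu t ht.1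
    rw [max_eq_left ht.1, huz ⟨ht.1, le_rfl⟩, hz.eq t ⟨ht.1, le_rfl⟩, hz0, hz0']
    congr 1
    refine intervalIntegral.integral_congr fun s hs => ?_
    rw [uIcc_of_le ht.1] at hs
    simp only [max_eq_left hs.1, huz hs]

end GlobalExistence

/-! ### From mild to strong solutions. -/

section StrongSolutions

variable {H : Type*} [NormedAddCommGroup H] [InnerProductSpace ℝ H] [CompleteSpace H]

/-- A Lipschitz function that is right differentiable everywhere is differentiable almost
everywhere, with the same derivative. -/
theorem ae_hasDerivAt_of_hasDerivWithinAt_Ici {z g : ℝ → H} {K : ℝ≥0}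
    (hlip : LipschitzOnWith K z (Ici 0))
    (hder : ∀ t, 0 ≤ t → HasDerivWithinAt z (g t) (Ici t) t) :
    ∀ᵐ t : ℝ, 0 < t → HasDerivAt z (g t) t := by
  have hg : ∀ t, 0 ≤ t → derivWithin z (Ici t) t = g t := fun t ht =>
    (hder t ht).derivWithin (uniqueDiffWithinAt_Ici t)
  have hbound : ∀ t, 0 ≤ t → ‖g t‖ ≤ K := by
    intro t ht
    refine le_of_tendsto (hasDerivWithinAt_Ici_iff_tendsto.1 (hder t ht)).norm ?_
    filter_upwards [self_mem_nhdsWithin] with h hh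
    have hh' : (0 : ℝ) < h := hh
    have h1 := hlip.dist_le_mul (t + h) (mem_Ici.2 (by linarith)) t ht
    rw [dist_eq_norm, Real.dist_eq, add_sub_cancel_left, abs_of_pos hh'] at h1
    rw [norm_smul, norm_inv, Real.norm_of_nonneg hh'.le, inv_mul_le_iff₀ hh']
    linarith
  have hint : ∀ τ, 0 ≤ τ → IntervalIntegrable g volume 0 τ := by
    intro τ hτ
    rw [intervalIntegrable_iff_integrableOn_Ioc_of_le hτ]
    have h1 : IntegrableOn (fun t => derivWithin z (Ici t) t) (Ioc 0 τ) := by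
      refine Measure.integrableOn_of_bounded (M := K) (by simp)
        (aestronglyMeasurable_derivWithin_Ici z _) ?_
      filter_upwards [ae_restrict_mem measurableSet_Ioc] with t ht
      rw [hg t ht.1.le]
      exact hbound t ht.1.le
    exact h1.congr_fun (fun t ht => hg t ht.1.le) measurableSet_Ioc
  -- The right derivative is bounded by the Lipschitz constant and measurable, so `z` is its
  -- primitive, and Lebesgue differentiation yields a two-sided derivative almost everywhere.
  have hftc : ∀ τ, 0 ≤ τ → z τ = z 0 + ∫ s in (0 : ℝ)..τ, g s := by
    intro τ hτ
    rw [intervalIntegral.integral_eq_sub_of_hasDeriv_right_of_le hτ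
      (hlip.continuousOn.mono Icc_subset_Ici_self)
      (fun t ht => (hder t ht.1.le).mono Ioi_subset_Ici_self) (hint τ hτ)]
    abel
  have hae : ∀ n : ℕ, ∀ᵐ t : ℝ, t ∈ Ioo (0 : ℝ) n → HasDerivAt z (g t) t := by
    intro n
    filter_upwards [(hint n n.cast_nonneg).ae_hasDerivAt_integral] with t ht htn
    have hmem : t ∈ uIcc (0 : ℝ) n := by
      rw [uIcc_of_le n.cast_nonneg]
      exact Ioo_subset_Icc_self htn
    refine ((ht hmem 0 left_mem_uIcc).const_add (z 0)).congr_of_eventuallyEq ?_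
    filter_upwards [Ioi_mem_nhds htn.1] with s hs
    exact hftc s (le_of_lt hs)
  filter_upwards [ae_all_iff.2 hae] with t ht hpos
  obtain ⟨n, hn⟩ := exists_nat_gt t
  exact ht n ⟨hpos, hn⟩

theorem exists_apply_eq_of_mem_graph {E F : Type*} [AddCommGroup E] [Module ℝ E] [AddCommGroup F]
    [Module ℝ F] {A : E →ₗ.[ℝ] F} {x : E} {y : F} (h : (x, y) ∈ A.graph) :
    ∃ hx : x ∈ A.domain, A ⟨x, hx⟩ = y := by
  obtain ⟨a, rfl, rfl⟩ := A.mem_graph_iff.1 h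
  exact ⟨a.2, rfl⟩

/-- Existence of a global strong solution of `z' = A z + G(z)`, with `A` the generator of a
contraction semigroup and `G` locally Lipschitz and dissipative. -/
theorem exists_strongSolution {A : H →ₗ.[ℝ] H} (hA : GeneratesContractionSemigroup A) {G : H → H}
    (hG : LocallyLipschitz G) (hdiss : IsDissipative G) (x : A.domain) :
    ∃ z : ℝ → H, Continuous z ∧ IsStrongSolution (fun y : A.domain => A y + G y) x z ∧
      (∀ t, 0 ≤ t → ∃ ht : z t ∈ A.domain,
        HasDerivWithinAt z (A ⟨z t, ht⟩ + G (z t)) (Ici t) t ∧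
        ‖A ⟨z t, ht⟩ + G (z t)‖ ≤ ‖A x + G x‖) := by
  obtain ⟨T, hT, hgen⟩ := hA.exists_isContractionSemigroup
  have hxA : ((x : H), A x) ∈ A.graph := A.mem_graph x
  obtain ⟨z, hz0, hlip, hz⟩ := exists_global_mildSolution hT hG hdiss hgen hxA
  have hmem : ∀ t, 0 ≤ t → ∃ y, (z t, y) ∈ A.graph := by
    intro t ht
    obtain ⟨ρ, hρ, hex⟩ := (hz (t + 1)).exists_expansion hT hG.continuous ⟨ht, by linarith⟩
    have hρ' : ∀ᶠ h in 𝓝[>] (0 : ℝ), ‖ρ h‖ < ‖G (z t)‖ + 1 :=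
      hρ.norm.eventually (gt_mem_nhds (by linarith))
    -- By the expansion, T(h)z(t) − z(t) is the increment of `z`, which is Lipschitz, minus h ρ(h),
    -- where ρ(h) is eventually bounded by ‖G(z(t))‖ + 1.
    refine hgen.exists_mem_graph_of_bounded hT (C := ‖A x + G x‖ + (‖G (z t)‖ + 1)) ?_
    filter_upwards [hex, hρ', self_mem_nhdsWithin] with h h1 h2 hh
    have hh' : (0 : ℝ) < h := hh
    have h3 := hlip.dist_le_mul (t + h) (mem_Ici.2 (by linarith)) t ht
    rw [dist_eq_norm, Real.dist_eq, add_sub_cancel_left, abs_of_pos hh', coe_nnnorm] at h3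
    have h4 : T h (z t) - z t = (z (t + h) - z t) - h • ρ h := by rw [h1]; abel
    rw [h4, norm_smul, norm_inv, Real.norm_of_nonneg hh'.le, inv_mul_le_iff₀ hh']
    refine (norm_sub_le _ _).trans ?_
    rw [norm_smul, Real.norm_of_nonneg hh'.le]
    nlinarith
  choose! y hy using hmem
  have hdom : ∀ t, 0 ≤ t → ∃ ht : z t ∈ A.domain, A ⟨z t, ht⟩ = y t := fun t ht =>
    exists_apply_eq_of_mem_graph (hy t ht)
  have hder : ∀ t, 0 ≤ t → HasDerivWithinAt z (y t + G (z t)) (Ici t) t := fun t ht =>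
    (hz (t + 1)).hasDerivWithinAt hT hG.continuous hgen ⟨ht, by linarith⟩ (hy t ht)
  refine ⟨z, (hz 0).continuous, ⟨hz0, fun τ hτ => ⟨?_, ?_⟩⟩, fun t ht => ?_⟩
  · refine LipschitzOnWith.absolutelyContinuousOnInterval (hlip.mono ?_)
    rw [uIcc_of_le hτ.le]
    exact Icc_subset_Ici_self
  · filter_upwards [ae_hasDerivAt_of_hasDerivWithinAt_Ici hlip hder] with t ht htτ
    obtain ⟨h1, h2⟩ := hdom t htτ.1.le
    refine ⟨h1, ?_⟩
    simp only [h2]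
    exact ht htτ.1
  · obtain ⟨h1, h2⟩ := hdom t ht
    refine ⟨h1, by rw [h2]; exact hder t ht, ?_⟩
    rw [h2]
    refine le_of_tendsto (hasDerivWithinAt_Ici_iff_tendsto.1 (hder t ht)).norm ?_
    filter_upwards [self_mem_nhdsWithin] with h hh
    have hh' : (0 : ℝ) < h := hh
    have h3 := hlip.dist_le_mul (t + h) (mem_Ici.2 (by linarith)) t ht
    rw [dist_eq_norm, Real.dist_eq, add_sub_cancel_left, abs_of_pos hh', coe_nnnorm] at h3
    rw [norm_smul, norm_inv, Real.norm_of_nonneg hh'.le, inv_mul_le_iff₀ hh']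
    linarith

end StrongSolutions

/-! ### Absolutely continuous functions under composition and differentiation. -/

section AbsolutelyContinuous

theorem AbsolutelyContinuousOnInterval.lipschitzOnWith_comp {X Y : Type*} [PseudoMetricSpace X]
    [PseudoMetricSpace Y] {z : ℝ → X} {V : X → Y} {a b : ℝ} {K : ℝ≥0}
    (hV : LipschitzOnWith K V (z '' uIcc a b)) (hz : AbsolutelyContinuousOnInterval z a b) :
    AbsolutelyContinuousOnInterval (fun t => V (z t)) a b := by
  rw [absolutelyContinuousOnInterval_iff] at hz ⊢
  intro ε hε
  obtain ⟨δ, hδ, h⟩ := hz (ε / (K + 1)) (by positivity)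
  refine ⟨δ, hδ, fun I hI hlen => ?_⟩
  calc ∑ i ∈ Finset.range I.1, dist (V (z (I.2 i).1)) (V (z (I.2 i).2))
      ≤ ∑ i ∈ Finset.range I.1, K * dist (z (I.2 i).1) (z (I.2 i).2) :=
        Finset.sum_le_sum fun i hi => hV.dist_le_mul _ (mem_image_of_mem z (hI.1 i hi).1) _
          (mem_image_of_mem z (hI.1 i hi).2)
    _ = K * ∑ i ∈ Finset.range I.1, dist (z (I.2 i).1) (z (I.2 i).2) := by rw [Finset.mul_sum]
    _ ≤ K * (ε / (K + 1)) := by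
        gcongr
        exact (h I hI hlen).le
    _ < (K + 1) * (ε / (K + 1)) := by gcongr; linarith
    _ = ε := by field_simp

theorem AbsolutelyContinuousOnInterval.contDiff_comp {E F : Type*} [NormedAddCommGroup E]
    [NormedSpace ℝ E] [NormedAddCommGroup F] [NormedSpace ℝ F] {z : ℝ → E} {V : E → F} {a b : ℝ}
    (hV : ContDiff ℝ 1 V) (hz : AbsolutelyContinuousOnInterval z a b) :
    AbsolutelyContinuousOnInterval (fun t => V (z t)) a b := by
  obtain ⟨K, hK⟩ := (hV.locallyLipschitz.locallyLipschitzOn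
    (s := z '' uIcc a b)).exists_lipschitzOnWith_of_compact
      (isCompact_uIcc.image_of_continuousOn hz.continuousOn)
  exact lipschitzOnWith_comp hK hz

theorem AbsolutelyContinuousOnInterval.le_of_ae_hasDerivAt_nonpos {φ : ℝ → ℝ} {a b : ℝ}
    (hab : a ≤ b) (hφ : AbsolutelyContinuousOnInterval φ a b)
    (hder : ∀ᵐ t : ℝ, t ∈ Ioo a b → ∃ d ≤ 0, HasDerivAt φ d t) : φ b ≤ φ a := by
  rw [← sub_nonpos, ← hφ.integral_deriv_eq_sub, intervalIntegral.integral_of_le hab,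
    integral_Ioc_eq_integral_Ioo]
  refine setIntegral_nonpos_of_ae_restrict ?_
  filter_upwards [ae_restrict_mem measurableSet_Ioo, ae_restrict_of_ae hder] with t ht h
  obtain ⟨d, hd, hd'⟩ := h ht
  rw [hd'.deriv]
  exact hd

end AbsolutelyContinuous

/-! ### Uniqueness of strong solutions. -/

section Uniqueness

variable {H : Type*} [NormedAddCommGroup H] [InnerProductSpace ℝ H]

theorem GeneratesContractionSemigroup.inner_nonpos {A : H →ₗ.[ℝ] H}
    (hA : GeneratesContractionSemigroup A) (x : A.domain) : ⟪A x, (x : H)⟫_ℝ ≤ 0 := by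
  obtain ⟨T, hT, hgen⟩ := hA.exists_isContractionSemigroup
  exact hgen.inner_nonpos hT (A.mem_graph x)

/-- Strong solutions of a dissipative equation are unique. -/
theorem IsStrongSolutionOn.eq_of_dissipative {A : H →ₗ.[ℝ] H}
    (hA : GeneratesContractionSemigroup A) {G : H → H} (hdiss : IsDissipative G) {τ : ℝ}
    (hτ : 0 ≤ τ) {z w : ℝ → H} (hz : IsStrongSolutionOn (fun y : A.domain => A y + G y) τ z)
    (hw : IsStrongSolutionOn (fun y : A.domain => A y + G y) τ w) (h0 : z 0 = w 0) :
    z τ = w τ := by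
  have hac : AbsolutelyContinuousOnInterval (fun t => ‖z t - w t‖ ^ 2) 0 τ :=
    AbsolutelyContinuousOnInterval.contDiff_comp (V := fun x : H => ‖x‖ ^ 2) (contDiff_norm_sq ℝ)
      (hz.absCont.sub hw.absCont)
  have hle := AbsolutelyContinuousOnInterval.le_of_ae_hasDerivAt_nonpos hτ hac (by
    filter_upwards [hz.ode, hw.ode] with t h1 h2 ht
    obtain ⟨hzt, hz'⟩ := h1 ht
    obtain ⟨hwt, hw'⟩ := h2 ht
    refine ⟨_, ?_, (hz'.sub hw').norm_sq⟩
    have h3 := hA.inner_nonpos (⟨z t, hzt⟩ - ⟨w t, hwt⟩)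
    have h4 := hdiss (z t) (w t)
    rw [LinearPMap.map_sub, real_inner_comm] at h3
    rw [real_inner_comm] at h4
    have h5 : ⟪z t - w t, A ⟨z t, hzt⟩ + G (z t) - (A ⟨w t, hwt⟩ + G (w t))⟫_ℝ =
        ⟪z t - w t, A ⟨z t, hzt⟩ - A ⟨w t, hwt⟩⟫_ℝ + ⟪z t - w t, G (z t) - G (w t)⟫_ℝ := by
      rw [← inner_add_right]
      congr 1
      abel
    simp only [AddSubgroupClass.coe_sub, Pi.sub_apply] at h3 ⊢
    rw [h5]
    linarith)
  simp only [h0, sub_self, norm_zero] at hle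
  have : ‖z τ - w τ‖ = 0 := by
    have := norm_nonneg (z τ - w τ)
    nlinarith
  exact sub_eq_zero.1 (norm_eq_zero.1 this)

end Uniqueness

/-! ### Decay from differential inequalities and discrete contraction. -/

section Comparison

theorem le_of_hasDerivWithinAt_Ici_nonpos {f f' : ℝ → ℝ} {a b : ℝ} (hab : a ≤ b)
    (hf : ContinuousOn f (Icc a b)) (hf' : ∀ t ∈ Ico a b, HasDerivWithinAt f (f' t) (Ici t) t)
    (hle : ∀ t ∈ Ico a b, f' t ≤ 0) : f b ≤ f a :=
  image_le_of_deriv_right_le_deriv_boundary hf hf' (B := fun _ => f a) (B' := fun _ => 0) le_rfl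
    continuousOn_const (fun _ _ => hasDerivWithinAt_const _ _ _) hle ⟨hab, le_rfl⟩

/-- A non-increasing function that is multiplied by at most `q < 1` over each time `τ` decays
exponentially. -/
theorem le_exp_of_contraction {f : ℝ → ℝ} {q τ : ℝ} (hq : 0 < q) (hq1 : q < 1) (hτ : 0 < τ)
    (hf0 : 0 ≤ f 0) (hanti : ∀ s t, 0 ≤ s → s ≤ t → f t ≤ f s)
    (hstep : ∀ s, 0 ≤ s → f (s + τ) ≤ q * f s) {t : ℝ} (ht : 0 ≤ t) :
    f t ≤ q⁻¹ * Real.exp (-(-Real.log q / τ) * t) * f 0 := by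
  have hpow : ∀ n : ℕ, f (n * τ) ≤ q ^ n * f 0 := by
    intro n
    induction n with
    | zero => simp
    | succ n ih =>
      push_cast
      rw [add_mul, one_mul]
      calc f (n * τ + τ) ≤ q * f (n * τ) := hstep _ (by positivity)
        _ ≤ q * (q ^ n * f 0) := by gcongr
        _ = q ^ (n + 1) * f 0 := by ring
  have hdiv : 0 ≤ t / τ := by positivity
  have h1 := Nat.floor_le hdiv
  have h2 := Nat.lt_floor_add_one (t / τ)
  have hlog : Real.log q < 0 := Real.log_neg hq hq1
  refine (hanti (⌊t / τ⌋₊ * τ) t (by positivity) ?_).trans ((hpow _).trans ?_)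
  · rwa [le_div_iff₀ hτ] at h1
  gcongr
  have h3 : q ^ ⌊t / τ⌋₊ = Real.exp (⌊t / τ⌋₊ * Real.log q) := by
    rw [mul_comm, Real.exp_mul, Real.exp_log hq, Real.rpow_natCast]
  -- Rounding t/τ down loses less than one step; the prefactor q⁻¹ compensates for it.
  have h4 : q⁻¹ * Real.exp (-(-Real.log q / τ) * t) = Real.exp ((t / τ - 1) * Real.log q) := by
    rw [sub_mul, one_mul, sub_eq_neg_add, Real.exp_add, Real.exp_neg, Real.exp_log hq]
    congr 2
    field_simp
  rw [h3, h4, Real.exp_le_exp]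
  nlinarith

end Comparison

/-! ### Consequences of the damping inequality. -/

section DampingInequality

variable {U : Type*} [NormedAddCommGroup U] [InnerProductSpace ℝ U]
  {S : Type*} [NormedAddCommGroup S] [NormedSpace ℝ S]
  {ι : S →L[ℝ] U} {σ : U → S} {C₁ C₂ : ℝ} {h : ℝ → ℝ}

theorem abs_inner_le_dualNorm (ι : S →L[ℝ] U) (u : U) (s : S) :
    |⟪u, ι s⟫_ℝ| ≤ dualNorm ι u * ‖s‖ := by
  simpa [dualNorm] using ((innerSL ℝ u).comp ι).le_opNorm s

theorem dualNorm_nonneg (ι : S →L[ℝ] U) (u : U) : 0 ≤ dualNorm ι u := norm_nonneg _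

/-- When S = U, test the functional on the preimage of `u` itself. -/
theorem norm_le_dualNorm (hiso : Isometry ι) (hsurj : Function.Surjective ι) (u : U) :
    ‖u‖ ≤ dualNorm ι u := by
  obtain ⟨s, rfl⟩ := hsurj u
  have h1 := abs_inner_le_dualNorm ι (ι s) s
  have h2 : ‖ι s‖ = ‖s‖ := hiso.norm_map_of_map_zero (map_zero ι) s
  rw [real_inner_self_eq_norm_sq, abs_of_nonneg (sq_nonneg _), ← h2, sq] at h1
  rcases (norm_nonneg (ι s)).eq_or_lt with h0 | h0
  · rw [← h0]
    exact dualNorm_nonneg _ _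
  · exact le_of_mul_le_mul_right h1 h0

theorem IsGain.pos (hh : IsGain h) {x : ℝ} (hx : 0 ≤ x) : 0 < h x :=
  hh.pos_zero.trans_le (hh.mono hx)

theorem DampingInequality.inner_nonneg (hC₂ : 0 < C₂) (hh : IsGain h)
    (hdamp : DampingInequality ι σ C₁ C₂ h) (s : S) : 0 ≤ ⟪ι (σ (ι s)), ι s⟫_ℝ := by
  have h1 := (dualNorm_nonneg ι _).trans (hdamp s)
  have h2 : 0 < C₂ * h ‖s‖ := mul_pos hC₂ (hh.pos (norm_nonneg s))
  exact nonneg_of_mul_nonneg_right h1 h2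

/-- At s = 0 the right-hand side vanishes, so σ(0) is orthogonal to the dense range of `ι`. The
origin is therefore an equilibrium, and dissipativity relative to it makes ‖z‖ non-increasing. -/
theorem DampingInequality.map_zero (hι : IsRigging ι) (hdamp : DampingInequality ι σ C₁ C₂ h) :
    ι (σ 0) = 0 := by
  have h1 := hdamp 0
  simp only [_root_.map_zero, smul_zero, sub_zero, inner_zero_right, mul_zero] at h1
  have h2 : ∀ s, ⟪ι (σ 0), ι s⟫_ℝ = 0 := by
    intro s
    have h3 := abs_inner_le_dualNorm ι (ι (σ 0)) s
    have h4 : dualNorm ι (ι (σ 0)) = 0 := le_antisymm h1 (dualNorm_nonneg _ _)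
    rw [h4, zero_mul] at h3
    exact abs_nonpos_iff.1 h3
  have h5 : (fun u : U => ⟪ι (σ 0), u⟫_ℝ) = fun _ => 0 :=
    hι.dense.equalizer (by fun_prop) continuous_const (funext h2)
  exact inner_self_eq_zero.1 (congrFun h5 (ι (σ 0)))

end DampingInequality

/-! ### The damping term and the key dissipation estimate. -/

section Damping

variable {H : Type*} [NormedAddCommGroup H] [InnerProductSpace ℝ H] [CompleteSpace H]
  {U : Type*} [NormedAddCommGroup U] [InnerProductSpace ℝ U] [CompleteSpace U]
  {S : Type*} [NormedAddCommGroup S] [NormedSpace ℝ S]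

/-- The damping term `-√k B σ(√k B* z)`. -/
noncomputable def dampingTerm (B : U →L[ℝ] H) (k : ℝ) (ι : S →L[ℝ] U) (σ : U → S) (z : H) : H :=
  -(√k • B (ι (σ (√k • ContinuousLinearMap.adjoint B z))))

variable {A : H →ₗ.[ℝ] H} {B : U →L[ℝ] H} {k : ℝ} {ι : S →L[ℝ] U} {σ : U → S} {C₁ C₂ : ℝ}
  {h : ℝ → ℝ}

theorem nonlinearClosedLoop_eq (A : H →ₗ.[ℝ] H) (B : U →L[ℝ] H) (k : ℝ) (ι : S →L[ℝ] U)
    (σ : U → S) :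
    nonlinearClosedLoop A B k ι σ = fun z : A.domain => A z + dampingTerm B k ι σ z := by
  funext z
  simp [nonlinearClosedLoop, dampingTerm, sub_eq_add_neg]

theorem linearClosedLoop_apply (A : H →ₗ.[ℝ] H) (B : U →L[ℝ] H) (k : ℝ) (z : A.domain) :
    linearClosedLoop A B k z = A z - k • B (ContinuousLinearMap.adjoint B (z : H)) := rfl

theorem inner_dampingTerm (x y : H) : ⟪x, dampingTerm B k ι σ y⟫_ℝ =
    -⟪√k • ContinuousLinearMap.adjoint B x, ι (σ (√k • ContinuousLinearMap.adjoint B y))⟫_ℝ := by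
  rw [dampingTerm, inner_neg_right, real_inner_smul_right, real_inner_smul_left,
    ContinuousLinearMap.adjoint_inner_left]

theorem locallyLipschitz_dampingTerm (hσ : LocallyLipschitz fun u => ι (σ u)) :
    LocallyLipschitz (dampingTerm B k ι σ) := by
  have h1 : LocallyLipschitz (-(√k • B)) := (-(√k • B)).lipschitz.locallyLipschitz
  have h2 : LocallyLipschitz (√k • ContinuousLinearMap.adjoint B) :=
    (√k • ContinuousLinearMap.adjoint B).lipschitz.locallyLipschitz
  exact (h1.comp hσ).comp h2

theorem isDissipative_dampingTerm (hmono : MonotoneDamping ι σ) :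
    IsDissipative (dampingTerm B k ι σ) := by
  intro x y
  have h1 := hmono (√k • ContinuousLinearMap.adjoint B x) (√k • ContinuousLinearMap.adjoint B y)
  rw [real_inner_comm, inner_sub_right, inner_dampingTerm, inner_dampingTerm, map_sub, smul_sub]
  rw [real_inner_comm, inner_sub_right] at h1
  linarith

theorem norm_adjoint_apply_le (B : U →L[ℝ] H) (x : H) :
    ‖ContinuousLinearMap.adjoint B x‖ ≤ ‖B‖ * ‖x‖ := by
  have h1 := (ContinuousLinearMap.adjoint B).le_opNorm x
  rwa [LinearIsometryEquiv.norm_map] at h1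

/-- The Lyapunov estimate behind exponential stability: the distance to the linear flow is
controlled by the dissipated energy, on bounded sets of the domain. -/
theorem exists_dissipation_constant (hA : GeneratesContractionSemigroup A) (hk : 0 < k)
    (hC₁ : 0 < C₁) (hC₂ : 0 < C₂) (hh : IsGain h) (hdamp : DampingInequality ι σ C₁ C₂ h) {cS : ℝ}
    (hcS : 0 ≤ cS)
    (hS : ∀ z : A.domain, ∃ s : S,
      ι s = ContinuousLinearMap.adjoint B (z : H) ∧ ‖s‖ ≤ cS * graphNorm A z)
    {r₁ r₂ : ℝ} (hr₁ : 0 ≤ r₁) (hr₂ : 0 ≤ r₂) :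
    ∃ c : ℝ, 0 ≤ c ∧ ∀ a b : A.domain, graphNorm A a ≤ r₁ → graphNorm A b ≤ r₂ →
      2 * ⟪(a : H) - b, A a + dampingTerm B k ι σ a - linearClosedLoop A B k b⟫_ℝ +
        c * (2 * ⟪(a : H), A a + dampingTerm B k ι σ a⟫_ℝ) ≤ 0 := by
  set R : ℝ := √k * (cS * r₁) with hR
  have hR0 : 0 ≤ R := by positivity
  have hhR : 0 < h R := hh.pos hR0
  -- With s = √k B*a, p = √k B*(a − b) and θ = ⟨σ(s), s⟩, two errors must be paid by the decay of
  -- ‖a‖². Here `c₁` covers ⟨σ(s) − C₁s, p⟩ through the S'–S pairing, and `c₂` covers the mismatch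
  -- (C₁ − 1)⟨s, p⟩ between the two feedback gains.
  set c₁ : ℝ := √k * (cS * (r₁ + r₂)) * (C₂ * h R) with hc₁
  set c₂ : ℝ := (C₁ - 1) ^ 2 / 4 * ((1 + R * (C₂ * h R)) / C₁) with hc₂
  refine ⟨c₁ + c₂, by positivity, fun a b ha hb => ?_⟩
  set p : U := √k • ContinuousLinearMap.adjoint B ((a : H) - b) with hp
  set s : U := √k • ContinuousLinearMap.adjoint B (a : H) with hs
  have hsq : √k * √k = k := Real.mul_self_sqrt hk.le
  have hB : ⟪(a : H) - b, k • B (ContinuousLinearMap.adjoint B (b : H))⟫_ℝ = ⟪p, s - p⟫_ℝ := by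
    have h1 : s - p = √k • ContinuousLinearMap.adjoint B (b : H) := by
      rw [hs, hp, map_sub, smul_sub]; abel
    rw [h1, hp, real_inner_smul_left, real_inner_smul_right, real_inner_smul_right,
      ContinuousLinearMap.adjoint_inner_left, ← mul_assoc, hsq]
  have hGw : ⟪(a : H) - b, dampingTerm B k ι σ a⟫_ℝ = -⟪p, ι (σ s)⟫_ℝ := inner_dampingTerm _ _
  have hGa : ⟪(a : H), dampingTerm B k ι σ a⟫_ℝ = -⟪s, ι (σ s)⟫_ℝ := inner_dampingTerm _ _
  clear_value p s
  set θ : ℝ := ⟪ι (σ s), s⟫_ℝ with hθ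
  obtain ⟨s₀, hs₀, hs₀n⟩ := hS a
  obtain ⟨p₀, hp₀, hp₀n⟩ := hS (a - b)
  have hιs : ι (√k • s₀) = s := by rw [map_smul, hs₀, hs]
  have hιp : ι (√k • p₀) = p := by rw [map_smul, hp₀]; simp [hp]
  have hsn : ‖√k • s₀‖ ≤ R := by
    rw [norm_smul, Real.norm_of_nonneg (Real.sqrt_nonneg k)]
    have : cS * graphNorm A a ≤ cS * r₁ := by gcongr
    rw [hR]
    gcongr
    exact hs₀n.trans this
  have hgab : graphNorm A (a - b) ≤ r₁ + r₂ := by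
    have h1 := norm_sub_le (a : H) b
    have h2 := norm_sub_le (A a) (A b)
    have h3 : graphNorm A (a - b) = ‖(a : H) - b‖ + ‖A a - A b‖ := by
      rw [graphNorm, LinearPMap.map_sub]; rfl
    rw [h3]
    simp only [graphNorm] at ha hb
    linarith
  have hpn : ‖√k • p₀‖ ≤ √k * (cS * (r₁ + r₂)) := by
    rw [norm_smul, Real.norm_of_nonneg (Real.sqrt_nonneg k)]
    have : cS * graphNorm A (a - b) ≤ cS * (r₁ + r₂) := by gcongr
    gcongr
    exact hp₀n.trans this
  have hθ0 : 0 ≤ θ := by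
    have := hdamp.inner_nonneg hC₂ hh (√k • s₀)
    rwa [hιs] at this
  have hdual : dualNorm ι (ι (σ s) - C₁ • s) ≤ C₂ * h R * θ := by
    have h1 := hdamp (√k • s₀)
    rw [hιs] at h1
    refine h1.trans ?_
    have h2 : h ‖√k • s₀‖ ≤ h R := hh.mono hsn
    gcongr
  have hps : |⟪ι (σ s) - C₁ • s, p⟫_ℝ| ≤ c₁ * θ := by
    have h1 := abs_inner_le_dualNorm ι (ι (σ s) - C₁ • s) (√k • p₀)
    rw [hιp] at h1
    calc |⟪ι (σ s) - C₁ • s, p⟫_ℝ| ≤ dualNorm ι (ι (σ s) - C₁ • s) * ‖√k • p₀‖ := h1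
      _ ≤ (C₂ * h R * θ) * (√k * (cS * (r₁ + r₂))) := by gcongr
      _ = c₁ * θ := by rw [hc₁]; ring
  -- Write C₁‖s‖² = θ − ⟨σ(s) − C₁s, s⟩ and bound the last term by the damping inequality.
  have hss : ‖s‖ ^ 2 ≤ (1 + R * (C₂ * h R)) / C₁ * θ := by
    have h1 := abs_inner_le_dualNorm ι (ι (σ s) - C₁ • s) (√k • s₀)
    rw [hιs] at h1
    have h2 : |⟪ι (σ s) - C₁ • s, s⟫_ℝ| ≤ (C₂ * h R * θ) * R :=
      h1.trans (by gcongr)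
    rw [inner_sub_left, real_inner_smul_left, real_inner_self_eq_norm_sq] at h2
    have h3 := (abs_le.1 h2).1
    rw [div_mul_eq_mul_div, le_div_iff₀ hC₁]
    linarith
  -- The coefficient of ‖p‖² is exactly what the linear feedback acting on the difference
  -- dissipates.
  have hyoung : -((C₁ - 1) * ⟪s, p⟫_ℝ) ≤ ‖p‖ ^ 2 + (C₁ - 1) ^ 2 / 4 * ‖s‖ ^ 2 := by
    have h1 := norm_add_sq_real p (((C₁ - 1) / 2) • s)
    rw [real_inner_smul_right, norm_smul, Real.norm_eq_abs, mul_pow, sq_abs,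
      real_inner_comm] at h1
    have h2 := sq_nonneg ‖p + ((C₁ - 1) / 2) • s‖
    linarith
  have hAw := hA.inner_nonpos (a - b)
  rw [LinearPMap.map_sub, real_inner_comm, AddSubgroupClass.coe_sub] at hAw
  have hAa := hA.inner_nonpos a
  rw [real_inner_comm] at hAa
  have e1 : ⟪(a : H) - b, A a + dampingTerm B k ι σ a - linearClosedLoop A B k b⟫_ℝ =
      ⟪(a : H) - b, A a - A b⟫_ℝ - ⟪ι (σ s) - C₁ • s, p⟫_ℝ - (C₁ - 1) * ⟪s, p⟫_ℝ - ‖p‖ ^ 2 := by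
    have h1 : A a + dampingTerm B k ι σ a - linearClosedLoop A B k b =
        (A a - A b) + dampingTerm B k ι σ a +
          k • B (ContinuousLinearMap.adjoint B (b : H)) := by
      rw [linearClosedLoop_apply]; abel
    rw [h1, inner_add_right, inner_add_right, hGw, hB, inner_sub_right p s p,
      real_inner_self_eq_norm_sq, inner_sub_left (ι (σ s)), real_inner_smul_left,
      real_inner_comm p (ι (σ s)), real_inner_comm p s]
    ring_nf
  have e2 : ⟪(a : H), A a + dampingTerm B k ι σ a⟫_ℝ = ⟪(a : H), A a⟫_ℝ - θ := by
    rw [inner_add_right, hGa, hθ, real_inner_comm s (ι (σ s))]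
    ring
  have hps' := (abs_le.1 hps).1
  have hss' : (C₁ - 1) ^ 2 / 4 * ‖s‖ ^ 2 ≤ c₂ * θ := by
    calc (C₁ - 1) ^ 2 / 4 * ‖s‖ ^ 2 ≤ (C₁ - 1) ^ 2 / 4 * ((1 + R * (C₂ * h R)) / C₁ * θ) := by
          gcongr
      _ = c₂ * θ := by rw [hc₂]; ring
  have hc : 0 ≤ c₁ + c₂ := by positivity
  have hfin : (c₁ + c₂) * (2 * (⟪(a : H), A a⟫_ℝ - θ)) ≤ (c₁ + c₂) * (2 * (0 - θ)) := by gcongr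
  rw [e1, e2]
  linarith

end Damping

/-! ### Semi-global exponential stability. -/

section SemiGlobal

variable {H : Type*} [NormedAddCommGroup H] [InnerProductSpace ℝ H] [CompleteSpace H]
  {U : Type*} [NormedAddCommGroup U] [InnerProductSpace ℝ U] [CompleteSpace U]
  {S : Type*} [NormedAddCommGroup S] [NormedSpace ℝ S]
  {A : H →ₗ.[ℝ] H} {B : U →L[ℝ] H} {k : ℝ} {ι : S →L[ℝ] U} {σ : U → S} {C₁ C₂ : ℝ}
  {h : ℝ → ℝ}

theorem dampingTerm_zero (hι : IsRigging ι) (hdamp : DampingInequality ι σ C₁ C₂ h) :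
    dampingTerm B k ι σ 0 = 0 := by
  simp [dampingTerm, hdamp.map_zero hι]

theorem exists_norm_dampingTerm_le (B : U →L[ℝ] H) (k : ℝ)
    (hbdd : ∀ R : ℝ, ∃ L : ℝ, ∀ u : U, ‖u‖ ≤ R → ‖ι (σ u)‖ ≤ L) (r : ℝ) :
    ∃ Γ : ℝ, 0 ≤ Γ ∧ ∀ x : H, ‖x‖ ≤ r → ‖dampingTerm B k ι σ x‖ ≤ Γ := by
  obtain ⟨L, hL⟩ := hbdd (√k * (‖B‖ * r))
  refine ⟨√k * (‖B‖ * |L|), by positivity, fun x hx => ?_⟩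
  rw [dampingTerm, norm_neg, norm_smul, Real.norm_of_nonneg (Real.sqrt_nonneg k)]
  gcongr
  refine (B.le_opNorm _).trans ?_
  gcongr
  refine (hL _ ?_).trans (le_abs_self L)
  rw [norm_smul, Real.norm_of_nonneg (Real.sqrt_nonneg k)]
  gcongr
  refine (norm_adjoint_apply_le B x).trans ?_
  gcongr

theorem norm_smul_apply_adjoint_le (B : U →L[ℝ] H) (hk : 0 < k) (x : H) :
    ‖k • B (ContinuousLinearMap.adjoint B x)‖ ≤ k * ‖B‖ ^ 2 * ‖x‖ := by
  rw [norm_smul, Real.norm_of_nonneg hk.le]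
  calc k * ‖B (ContinuousLinearMap.adjoint B x)‖ ≤ k * (‖B‖ * (‖B‖ * ‖x‖)) := by
        gcongr
        refine (B.le_opNorm _).trans ?_
        gcongr
        exact norm_adjoint_apply_le B x
    _ = k * ‖B‖ ^ 2 * ‖x‖ := by ring

/-- Orbits of the linear closed loop stay bounded in the graph norm of `A`. -/
theorem exists_graphNorm_orbit_le (hk : 0 < k) {T : ℝ → H →L[ℝ] H} (hT : IsC0Semigroup T)
    (hgen : IsGenerator T (linearClosedLoop A B k)) {C : ℝ} (hC : 0 ≤ C)
    (hTC : ∀ (z : H) (t : ℝ), 0 ≤ t → ‖T t z‖ ≤ C * ‖z‖) {r : ℝ} (hr : 0 ≤ r) :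
    ∃ r' : ℝ, 0 ≤ r' ∧ ∀ x : A.domain, graphNorm A x ≤ r → ∀ t, 0 ≤ t →
      ∃ ht : T t x ∈ A.domain, linearClosedLoop A B k ⟨T t x, ht⟩ = T t (linearClosedLoop A B k x) ∧
        graphNorm A ⟨T t x, ht⟩ ≤ r' := by
  set β := k * ‖B‖ ^ 2 with hβ
  have hβ0 : 0 ≤ β := by positivity
  -- The semigroup commutes with its generator A − kBB*, so that image stays bounded along the
  -- orbit; the bounded term, of norm at most β, converts between it and `A`.
  refine ⟨C * r + (C * (r + β * r) + β * (C * r)), by positivity, fun x hx t ht => ?_⟩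
  obtain ⟨hmem, heq⟩ := exists_apply_eq_of_mem_graph
    (hgen.map_mem_graph hT ((linearClosedLoop A B k).mem_graph x) ht)
  change T t x ∈ A.domain at hmem
  refine ⟨hmem, heq, ?_⟩
  have hx1 : ‖(x : H)‖ ≤ r := by
    have := norm_nonneg (A x)
    simp only [graphNorm] at hx
    linarith
  have hx2 : ‖A x‖ ≤ r := by
    have := norm_nonneg (x : H)
    simp only [graphNorm] at hx
    linarith
  have h1 : ‖T t x‖ ≤ C * r := (hTC x t ht).trans (by gcongr)
  have h2 : ‖linearClosedLoop A B k x‖ ≤ r + β * r := by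
    rw [linearClosedLoop_apply]
    refine (norm_sub_le _ _).trans ?_
    have h3 := norm_smul_apply_adjoint_le B hk (x : H)
    have h4 : β * ‖(x : H)‖ ≤ β * r := by gcongr
    linarith
  have h3 : ‖linearClosedLoop A B k ⟨T t x, hmem⟩‖ ≤ C * (r + β * r) := by
    rw [heq]
    exact (hTC _ t ht).trans (by gcongr)
  have h4 : ‖A ⟨T t x, hmem⟩‖ ≤ C * (r + β * r) + β * (C * r) := by
    have h5 : A ⟨T t x, hmem⟩ = linearClosedLoop A B k ⟨T t x, hmem⟩ +
        k • B (ContinuousLinearMap.adjoint B (T t x)) := (sub_add_cancel _ _).symm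
    rw [h5]
    refine (norm_add_le _ _).trans ?_
    have h6 := norm_smul_apply_adjoint_le B hk (T t x)
    have h7 : β * ‖T t x‖ ≤ β * (C * r) := by gcongr
    linarith
  simp only [graphNorm]
  linarith

theorem exists_time_decay {C α : ℝ} (hC : 0 < C) (hα : 0 < α) :
    ∃ τ > 0, C * Real.exp (-α * τ) ≤ 1 / 2 := by
  -- With this time the claim is 2C ≤ exp(2C).
  refine ⟨2 * C / α, by positivity, ?_⟩
  have h1 : -α * (2 * C / α) = -(2 * C) := by field_simp
  have h2 := Real.add_one_le_exp (2 * C)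
  rw [h1, Real.exp_neg, ← div_eq_mul_inv, div_le_iff₀ (Real.exp_pos _)]
  linarith

/-- Exponential decay of strong solutions, uniformly on balls of the domain. -/
theorem exists_exponential_decay (hι : IsRigging ι) (hA : GeneratesContractionSemigroup A)
    (hk : 0 < k) (hexp : GloballyExpStable (linearClosedLoop A B k)) (hC₁ : 0 < C₁)
    (hC₂ : 0 < C₂) (hh : IsGain h) (hdamp : DampingInequality ι σ C₁ C₂ h)
    (hmono : MonotoneDamping ι σ)
    (hbdd : ∀ R : ℝ, ∃ L : ℝ, ∀ u : U, ‖u‖ ≤ R → ‖ι (σ u)‖ ≤ L) {cS : ℝ} (hcS : 0 ≤ cS)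
    (hS : ∀ z : A.domain, ∃ s : S,
      ι s = ContinuousLinearMap.adjoint B (z : H) ∧ ‖s‖ ≤ cS * graphNorm A z)
    {r : ℝ} (hr : 0 < r) :
    ∃ K > 0, ∃ μ > 0, ∀ x : A.domain, graphNorm A x ≤ r → ∀ z : ℝ → H, z 0 = x → Continuous z →
      (∀ t, 0 ≤ t → ∃ ht : z t ∈ A.domain,
        HasDerivWithinAt z (A ⟨z t, ht⟩ + dampingTerm B k ι σ (z t)) (Ici t) t ∧
        ‖A ⟨z t, ht⟩ + dampingTerm B k ι σ (z t)‖ ≤ ‖A x + dampingTerm B k ι σ x‖) →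
      ∀ t, 0 ≤ t → ‖z t‖ ≤ K * Real.exp (-μ * t) * ‖(x : H)‖ := by
  obtain ⟨T, hT, hgen, C, hC, α, hα, hdecay⟩ := hexp
  have hTC : ∀ (z : H) (t : ℝ), 0 ≤ t → ‖T t z‖ ≤ C * ‖z‖ := by
    intro z t ht
    refine (hdecay z t ht).trans ?_
    gcongr
    refine mul_le_of_le_one_right hC.le ?_
    rw [Real.exp_le_one_iff]
    nlinarith
  obtain ⟨Γ, hΓ0, hΓ⟩ := exists_norm_dampingTerm_le B k hbdd r
  -- The norm of z and that of A z + G z, with G the damping term, never exceed their initial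
  -- values, so ‖A z‖ ≤ ‖A x‖ + 2Γ: one Γ is spent at the initial point and one at time t. This
  -- bound holds at all times, which makes the later contraction step uniform in its starting time.
  have hr₁ : 0 ≤ r + 2 * Γ := by positivity
  obtain ⟨r₂, hr₂, horbit⟩ := exists_graphNorm_orbit_le hk hT hgen hC.le hTC hr₁
  obtain ⟨c, hc, hdiss⟩ := exists_dissipation_constant (B := B) hA hk hC₁ hC₂ hh hdamp hcS hS hr₁ hr₂
  obtain ⟨τ, hτ, hτC⟩ := exists_time_decay hC hα
  -- Let D be the gap between the two flows at time τ. From D² + c‖z(s+τ)‖² ≤ c‖z(s)‖² and ‖z(s+τ)‖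
  -- ≤ D + ½‖z(s)‖, squaring gives (1 + 2c)‖z(s+τ)‖² ≤ (2c + ½)‖z(s)‖².
  set Q : ℝ := (2 * c + 1 / 2) / (1 + 2 * c) with hQ
  have hQ0 : 0 < Q := by positivity
  have hQ1 : Q < 1 := by rw [hQ, div_lt_one (by positivity)]; linarith
  have hq0 : 0 < √Q := Real.sqrt_pos.2 hQ0
  have hq1 : √Q < 1 := by rw [Real.sqrt_lt' one_pos]; simpa using hQ1
  have hlog : 0 < -Real.log (√Q) / τ := div_pos (neg_pos.2 (Real.log_neg hq0 hq1)) hτ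
  refine ⟨(√Q)⁻¹, inv_pos.2 hq0, _, hlog, fun x hx z hz0 hzc hz t ht => ?_⟩
  choose hdom hder hbound using hz
  -- This names the right derivative as a total function, free of the proof that z(t) is in the
  -- domain.
  set g : ℝ → H := fun t => derivWithin z (Ici t) t with hg
  have hgeq : ∀ t (ht : 0 ≤ t), g t = A ⟨z t, hdom t ht⟩ + dampingTerm B k ι σ (z t) :=
    fun t ht => (hder t ht).derivWithin (uniqueDiffWithinAt_Ici t)
  have hderg : ∀ t, 0 ≤ t → HasDerivWithinAt z (g t) (Ici t) t := fun t ht => by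
    rw [hgeq t ht]; exact hder t ht
  have hanti : ∀ s t, 0 ≤ s → s ≤ t → ‖z t‖ ≤ ‖z s‖ := by
    intro s t hs hst
    have h1 := le_of_hasDerivWithinAt_Ici_nonpos (f := fun t => ‖z t‖ ^ 2)
      (f' := fun t => 2 * ⟪z t, g t⟫_ℝ) hst (hzc.norm.pow 2).continuousOn
      (fun t ht => (hderg t (hs.trans ht.1)).norm_sq) (fun t ht => by
        have ht0 := hs.trans ht.1
        have h2 := hA.inner_nonpos ⟨z t, hdom t ht0⟩
        have h3 := isDissipative_dampingTerm (B := B) (k := k) hmono (z t) 0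
        rw [dampingTerm_zero hι hdamp, sub_zero, sub_zero] at h3
        rw [hgeq t ht0, inner_add_right, real_inner_comm, real_inner_comm _ (z t)]
        dsimp only at h2
        linarith)
    exact (sq_le_sq₀ (norm_nonneg _) (norm_nonneg _)).1 h1
  have hx1 : ‖(x : H)‖ ≤ r := by
    have := norm_nonneg (A x)
    simp only [graphNorm] at hx
    linarith
  have hzr : ∀ t, 0 ≤ t → ‖z t‖ ≤ ‖(x : H)‖ := fun t ht => by
    have := hanti 0 t le_rfl ht
    rwa [hz0] at this
  have hgraph : ∀ t (ht : 0 ≤ t), graphNorm A ⟨z t, hdom t ht⟩ ≤ r + 2 * Γ := by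
    intro t ht
    have h1 := hΓ (z t) ((hzr t ht).trans hx1)
    have h2 := hΓ x hx1
    have h3 := norm_sub_le (A ⟨z t, hdom t ht⟩ + dampingTerm B k ι σ (z t))
      (dampingTerm B k ι σ (z t))
    rw [add_sub_cancel_right] at h3
    have h4 := norm_add_le (A x) (dampingTerm B k ι σ x)
    have h5 := hzr t ht
    have h6 := hbound t ht
    simp only [graphNorm] at hx ⊢
    linarith
  have hstep : ∀ s, 0 ≤ s → ‖z (s + τ)‖ ≤ √Q * ‖z s‖ := by
    intro s hs
    set y : A.domain := ⟨z s, hdom s hs⟩ with hy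
    have hycont : ContinuousOn (fun t => T t (z s)) (Icc 0 τ) :=
      (hT.continuousOn (z s)).mono Icc_subset_Ici_self
    have hshift : ∀ t, 0 ≤ t → HasDerivWithinAt (fun t => z (s + t)) (g (s + t)) (Ici t) t := by
      intro t ht
      have h1 := hasDerivWithinAt_Ici_iff_tendsto.1 (hderg (s + t) (by positivity))
      rw [hasDerivWithinAt_Ici_iff_tendsto]
      simpa only [add_assoc] using h1
    have horb : ∀ t, 0 ≤ t → HasDerivWithinAt (fun t => T t (z s))
        (T t (linearClosedLoop A B k y)) (Ici t) t := fun t ht =>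
      hgen.hasDerivWithinAt_orbit hT ((linearClosedLoop A B k).mem_graph y) ht
    -- The linear orbit is restarted at z(s), so the first term vanishes at t = 0 and only c‖z(s)‖²
    -- remains on the right.
    have hle := le_of_hasDerivWithinAt_Ici_nonpos hτ.le
      (f := fun t => ‖z (s + t) - T t (z s)‖ ^ 2 + c * ‖z (s + t)‖ ^ 2)
      (f' := fun t => 2 * ⟪z (s + t) - T t (z s), g (s + t) - T t (linearClosedLoop A B k y)⟫_ℝ +
        c * (2 * ⟪z (s + t), g (s + t)⟫_ℝ))
      ((((hzc.comp (by fun_prop : Continuous fun t => s + t)).continuousOn.sub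
        hycont).norm.pow 2).add
        (((hzc.comp (by fun_prop : Continuous fun t => s + t)).norm.pow 2).const_mul
          c).continuousOn)
      (fun t ht => ((hshift t ht.1).sub (horb t ht.1)).norm_sq.add
        ((hshift t ht.1).norm_sq.const_mul c))
      (fun t ht => by
        have hst : 0 ≤ s + t := add_nonneg hs ht.1
        obtain ⟨hm, heq, hgn⟩ := horbit y (hgraph s hs) t ht.1
        have h1 := hdiss ⟨z (s + t), hdom _ hst⟩ ⟨T t y, hm⟩ (hgraph _ hst) hgn
        rw [← hgeq _ hst] at h1
        have h2 := congrArg (fun v => 2 * ⟪z (s + t) - T t (z s), g (s + t) - v⟫_ℝ +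
          c * (2 * ⟪z (s + t), g (s + t)⟫_ℝ)) heq
        exact h2.symm.le.trans h1)
    simp only [add_zero, hT.map_zero, ContinuousLinearMap.id_apply, sub_self, norm_zero] at hle
    have h1 : ‖T τ (z s)‖ ≤ 1 / 2 * ‖z s‖ := (hdecay (z s) τ hτ.le).trans (by gcongr)
    have h2 : ‖z (s + τ)‖ ≤ ‖z (s + τ) - T τ (z s)‖ + 1 / 2 * ‖z s‖ := by
      have := norm_le_norm_sub_add (z (s + τ)) (T τ (z s))
      linarith
    have h3 : ‖z (s + τ)‖ ^ 2 ≤ Q * ‖z s‖ ^ 2 := by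
      rw [hQ, div_mul_eq_mul_div, le_div_iff₀ (by positivity)]
      have h4 : ‖z (s + τ)‖ ^ 2 ≤ (‖z (s + τ) - T τ (z s)‖ + 1 / 2 * ‖z s‖) ^ 2 := by gcongr
      nlinarith [sq_nonneg (‖z (s + τ) - T τ (z s)‖ - 1 / 2 * ‖z s‖)]
    calc ‖z (s + τ)‖ = √(‖z (s + τ)‖ ^ 2) := (Real.sqrt_sq (norm_nonneg _)).symm
      _ ≤ √(Q * ‖z s‖ ^ 2) := Real.sqrt_le_sqrt h3
      _ = √Q * ‖z s‖ := by rw [Real.sqrt_mul hQ0.le, Real.sqrt_sq (norm_nonneg _)]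
  have hfin := le_exp_of_contraction (f := fun t => ‖z t‖) hq0 hq1 hτ (norm_nonneg _) hanti hstep ht
  rwa [hz0] at hfin

/-- Semi-global exponential stability for a monotone damping. -/
theorem semiGloballyExpStable_of_monotone (hι : IsRigging ι)
    (hA : GeneratesContractionSemigroup A) (hk : 0 < k)
    (hexp : GloballyExpStable (linearClosedLoop A B k)) (hσ : LocallyLipschitz fun u => ι (σ u))
    (hC₁ : 0 < C₁) (hC₂ : 0 < C₂) (hh : IsGain h) (hdamp : DampingInequality ι σ C₁ C₂ h)
    (hmono : MonotoneDamping ι σ)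
    (hbdd : ∀ R : ℝ, ∃ L : ℝ, ∀ u : U, ‖u‖ ≤ R → ‖ι (σ u)‖ ≤ L)
    (hS : ∃ cS : ℝ, ∀ z : A.domain, ∃ s : S,
      ι s = ContinuousLinearMap.adjoint B (z : H) ∧ ‖s‖ ≤ cS * graphNorm A z) :
    SemiGloballyExpStable A (nonlinearClosedLoop A B k ι σ) := by
  classical
  obtain ⟨cS, hcS⟩ := hS
  have hS' : ∀ z : A.domain, ∃ s : S,
      ι s = ContinuousLinearMap.adjoint B (z : H) ∧ ‖s‖ ≤ |cS| * graphNorm A z := by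
    intro z
    obtain ⟨s, hs, hsn⟩ := hcS z
    refine ⟨s, hs, hsn.trans ?_⟩
    have : 0 ≤ graphNorm A z := by simp only [graphNorm]; positivity
    gcongr
    exact le_abs_self cS
  have hdiss : IsDissipative (dampingTerm B k ι σ) := isDissipative_dampingTerm hmono
  choose Z hZc hZ hZd using
    fun x : A.domain => exists_strongSolution hA (locallyLipschitz_dampingTerm (B := B) (k := k) hσ)
      hdiss x
  have hW : ∀ (t : ℝ) (x : A.domain),
      (if hx : (x : H) ∈ A.domain then Z ⟨x, hx⟩ t else 0) = Z x t := fun t x => by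
    rw [dif_pos x.2]
  rw [nonlinearClosedLoop_eq]
  refine ⟨fun t x => if hx : x ∈ A.domain then Z ⟨x, hx⟩ t else 0, fun x => ?_, fun r hr => ?_⟩
  · simp only [hW]
    refine ⟨hZ x, fun z hz t ht => ?_⟩
    have h0 : z 0 = Z x 0 := hz.init.trans (hZ x).init.symm
    rcases ht.eq_or_lt with rfl | hpos
    · exact h0
    · exact IsStrongSolutionOn.eq_of_dissipative hA hdiss ht (hz.sol t hpos) ((hZ x).sol t hpos) h0
  · obtain ⟨K, hK, μ, hμ, hdecay⟩ := exists_exponential_decay hι hA hk hexp hC₁ hC₂ hh hdamp hmono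
      hbdd (abs_nonneg cS) hS' hr
    refine ⟨K, hK, μ, hμ, fun x hx t ht => ?_⟩
    simp only [hW]
    exact hdecay x hx (Z x) (hZ x).init (hZc x) (hZd x) t ht

end SemiGlobal

/-! ### A quadratic Lyapunov form for the linear closed loop. -/

section LyapunovOperator

variable {H : Type*} [NormedAddCommGroup H] [InnerProductSpace ℝ H] [CompleteSpace H]

/-- The Gramian `∫₀^τ T(t)* T(t) dt` of a bounded, strongly continuous family of operators. -/
theorem exists_gramian {T : ℝ → H →L[ℝ] H} (hT : ∀ z, Continuous fun t => T t z) {C : ℝ}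
    (hTC : ∀ (z : H) (t : ℝ), ‖T t z‖ ≤ C * ‖z‖) (τ : ℝ) :
    ∃ P : H →L[ℝ] H, IsSelfAdjoint P ∧
      ∀ z w : H, ⟪P z, w⟫_ℝ = ∫ t in (0 : ℝ)..τ, ⟪T t z, T t w⟫_ℝ := by
  have hi : ∀ z w : H, IntervalIntegrable (fun t => ⟪T t z, T t w⟫_ℝ) volume 0 τ := fun z w =>
    ((hT z).inner (hT w)).intervalIntegrable _ _
  let b : H →ₗ[ℝ] H →ₗ[ℝ] ℝ := LinearMap.mk₂ ℝ
    (fun z w => ∫ t in (0 : ℝ)..τ, ⟪T t z, T t w⟫_ℝ)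
    (fun z₁ z₂ w => by
      simp only [map_add, inner_add_left]
      exact intervalIntegral.integral_add (hi _ _) (hi _ _))
    (fun c z w => by
      simp only [map_smul, real_inner_smul_left]
      exact intervalIntegral.integral_const_mul _ _)
    (fun z w₁ w₂ => by
      simp only [map_add, inner_add_right]
      exact intervalIntegral.integral_add (hi _ _) (hi _ _))
    (fun c z w => by
      simp only [map_smul, real_inner_smul_right]
      exact intervalIntegral.integral_const_mul _ _)
  let b' : H →L[ℝ] H →L[ℝ] ℝ := b.mkContinuous₂ (C * C * |τ|) fun z w => by
    have h1 := intervalIntegral.norm_integral_le_of_norm_le_const (a := 0) (b := τ)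
      (f := fun t => ⟪T t z, T t w⟫_ℝ) (C := (C * ‖z‖) * (C * ‖w‖)) fun t _ => by
        refine (norm_inner_le_norm _ _).trans ?_
        have := hTC z t
        have := hTC w t
        have : 0 ≤ C * ‖z‖ := (norm_nonneg _).trans (hTC z t)
        gcongr
    rw [sub_zero] at h1
    calc ‖b z w‖ ≤ (C * ‖z‖) * (C * ‖w‖) * |τ| := h1
      _ = C * C * |τ| * ‖z‖ * ‖w‖ := by ring
  let P : H →L[ℝ] H := InnerProductSpace.continuousLinearMapOfBilin b'
  have hP : ∀ z w : H, ⟪P z, w⟫_ℝ = ∫ t in (0 : ℝ)..τ, ⟪T t z, T t w⟫_ℝ := fun z w =>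
    InnerProductSpace.continuousLinearMapOfBilin_apply b' z w
  refine ⟨P, ContinuousLinearMap.isSelfAdjoint_iff_isSymmetric.2 fun z w => ?_, hP⟩
  change ⟪P z, w⟫_ℝ = ⟪z, P w⟫_ℝ
  rw [real_inner_comm (P w) z, hP, hP]
  simp only [real_inner_comm]

/-- An exponentially stable generator admits a quadratic Lyapunov function. -/
theorem GloballyExpStable.exists_lyapunov_operator {L : H →ₗ.[ℝ] H} (hL : GloballyExpStable L) :
    ∃ P : H →L[ℝ] H, IsSelfAdjoint P ∧ (∀ z, 0 ≤ ⟪P z, z⟫_ℝ) ∧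
      ∀ z : L.domain, 2 * ⟪P z, L z⟫_ℝ ≤ -(1 / 2) * ‖(z : H)‖ ^ 2 := by
  obtain ⟨T, hT, hgen, C, hC, α, hα, hdecay⟩ := hL
  obtain ⟨τ, hτ, hτC⟩ := exists_time_decay hC hα
  have hcont : ∀ z, Continuous fun t => T (max t 0) z := fun z =>
    (hT.continuousOn z).comp_continuous (f := fun t : ℝ => max t 0) (by fun_prop)
      fun t => le_max_right t 0
  have hTC : ∀ (z : H) (t : ℝ), ‖T (max t 0) z‖ ≤ C * ‖z‖ := by
    intro z t
    refine (hdecay z _ (le_max_right _ _)).trans ?_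
    gcongr
    refine mul_le_of_le_one_right hC.le ?_
    rw [Real.exp_le_one_iff]
    nlinarith [le_max_right t 0]
  obtain ⟨P, hPsa, hP⟩ := exists_gramian hcont hTC τ
  have hsymm : ∀ x y : H, ⟪P x, y⟫_ℝ = ⟪x, P y⟫_ℝ :=
    ContinuousLinearMap.isSelfAdjoint_iff_isSymmetric.1 hPsa
  refine ⟨P, hPsa, fun z => ?_, fun z => ?_⟩
  · rw [hP]
    exact intervalIntegral.integral_nonneg hτ.le fun t _ => real_inner_self_nonneg
  set φ : ℝ → ℝ := fun t => ⟪T (max t 0) (z : H), T (max t 0) z⟫_ℝ with hφ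
  have hφc : Continuous φ := (hcont z).inner (hcont z)
  have hF : ∀ x, HasDerivAt (fun x => ∫ t in (0 : ℝ)..x, φ t) (φ x) x := fun x =>
    intervalIntegral.integral_hasDerivAt_right (hφc.intervalIntegrable _ _)
      (hφc.stronglyMeasurableAtFilter _ _) hφc.continuousAt
  -- The semigroup law turns the form along the orbit into ∫ φ over `[h, τ + h]`. Equating the two
  -- right derivatives at h = 0 gives 2⟨P z, L z⟩ = ‖T(τ)z‖² − ‖z‖², which is at most −¾‖z‖² because
  -- ‖T(τ)z‖ ≤ ½‖z‖.
  have hshift : EqOn (fun h => ⟪P (T h z), T h z⟫_ℝ)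
      (fun h => (∫ t in (0 : ℝ)..(τ + h), φ t) - ∫ t in (0 : ℝ)..h, φ t) (Ici 0) := by
    intro h hh
    have hh' : 0 ≤ h := hh
    have e1 := intervalIntegral.integral_comp_add_right (a := 0) (b := τ) φ h
    rw [zero_add] at e1
    simp only
    rw [intervalIntegral.integral_interval_sub_left (hφc.intervalIntegrable _ _)
      (hφc.intervalIntegrable _ _), ← e1, hP]
    refine intervalIntegral.integral_congr fun t ht => ?_
    rw [uIcc_of_le hτ.le] at ht
    simp only [hφ, max_eq_left ht.1, max_eq_left (add_nonneg ht.1 hh'), hT.map_add t h ht.1 hh',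
      ContinuousLinearMap.comp_apply]
  have hd1 : HasDerivWithinAt
      (fun h => (∫ t in (0 : ℝ)..(τ + h), φ t) - ∫ t in (0 : ℝ)..h, φ t) (φ τ - φ 0) (Ici 0) 0 := by
    have h1 : HasDerivAt (fun h => ∫ t in (0 : ℝ)..(τ + h), φ t) (φ τ) 0 :=
      HasDerivAt.comp_const_add τ 0 (by simpa using hF τ)
    exact (h1.sub (hF 0)).hasDerivWithinAt
  have horb : HasDerivWithinAt (fun h => T h (z : H)) (L z) (Ici 0) 0 := by
    simpa [hT.map_zero] using hgen.hasDerivWithinAt_orbit hT (L.mem_graph z) le_rfl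
  have hd2 : HasDerivWithinAt (fun h => ⟪P (T h z), T h z⟫_ℝ)
      (⟪P (T 0 z), L z⟫_ℝ + ⟪P (L z), T 0 z⟫_ℝ) (Ici 0) 0 :=
    (P.hasFDerivAt.comp_hasDerivWithinAt 0 horb).inner ℝ horb
  have heq := (uniqueDiffWithinAt_Ici (0 : ℝ)).eq_deriv _ hd2
    (hd1.congr hshift (hshift self_mem_Ici))
  have hφ0 : φ 0 = ‖(z : H)‖ ^ 2 := by
    simp [hφ, hT.map_zero]
  have hφτ : φ τ ≤ (1 / 2 * ‖(z : H)‖) ^ 2 := by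
    have h1 : ‖T τ (z : H)‖ ≤ 1 / 2 * ‖(z : H)‖ := (hdecay z τ hτ.le).trans (by gcongr)
    simp only [hφ, max_eq_left hτ.le, real_inner_self_eq_norm_sq]
    gcongr
  rw [hT.map_zero, ContinuousLinearMap.id_apply, hsymm (L z) z, real_inner_comm (P z) (L z),
    hφ0] at heq
  nlinarith [sq_nonneg ‖(z : H)‖]

end LyapunovOperator

/-! ### Regularity and bounds of the nonlinear Lyapunov function. -/

section LyapunovFunction

variable {H : Type*} [NormedAddCommGroup H] [InnerProductSpace ℝ H]

theorem continuous_sqrt_mul_gain {h : ℝ → ℝ} (hh : Continuous h) (b : ℝ) :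
    Continuous fun v => √v * h (b * √v) := by fun_prop

theorem hasDerivAt_integral_gain {h : ℝ → ℝ} (hh : Continuous h) (b x : ℝ) :
    HasDerivAt (fun x => ∫ v in (0 : ℝ)..x, √v * h (b * √v)) (√x * h (b * √x)) x :=
  intervalIntegral.integral_hasDerivAt_right
    ((continuous_sqrt_mul_gain hh b).intervalIntegrable _ _)
    ((continuous_sqrt_mul_gain hh b).stronglyMeasurableAtFilter _ _)
    (continuous_sqrt_mul_gain hh b).continuousAt

theorem contDiff_integral_gain {h : ℝ → ℝ} (hh : Continuous h) (b : ℝ) :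
    ContDiff ℝ 1 fun x => ∫ v in (0 : ℝ)..x, √v * h (b * √v) := by
  refine contDiff_one_iff_deriv.2 ⟨fun x => (hasDerivAt_integral_gain hh b x).differentiableAt, ?_⟩
  rw [show deriv (fun x => ∫ v in (0 : ℝ)..x, √v * h (b * √v)) = fun x => √x * h (b * √x) from
    funext fun x => (hasDerivAt_integral_gain hh b x).deriv]
  exact continuous_sqrt_mul_gain hh b

theorem monotone_integral_gain {h : ℝ → ℝ} (hh : IsGain h) (b : ℝ) :
    Monotone fun x => ∫ v in (0 : ℝ)..x, √v * h (b * √v) :=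
  monotone_of_hasDerivAt_nonneg (hasDerivAt_integral_gain hh.continuous b)
    fun x => mul_nonneg (Real.sqrt_nonneg x) (hh.nonneg _)

theorem contDiff_lyapunovFunction {h : ℝ → ℝ} (hh : Continuous h) (P : H →L[ℝ] H) (M b : ℝ) :
    ContDiff ℝ 1 (lyapunovFunction P M h b) :=
  (P.contDiff.inner ℝ contDiff_id).add
    (contDiff_const.mul ((contDiff_integral_gain hh b).comp (contDiff_norm_sq ℝ)))

theorem fderiv_lyapunovFunction_apply [CompleteSpace H] {h : ℝ → ℝ} (hh : Continuous h) {P : H →L[ℝ] H}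
    (hP : IsSelfAdjoint P) (M b : ℝ) (z v : H) :
    fderiv ℝ (lyapunovFunction P M h b) z v =
      2 * ⟪P z, v⟫_ℝ + M * (‖z‖ * h (b * ‖z‖)) * (2 * ⟪z, v⟫_ℝ) := by
  have hsymm : ∀ x y : H, ⟪P x, y⟫_ℝ = ⟪x, P y⟫_ℝ :=
    ContinuousLinearMap.isSelfAdjoint_iff_isSymmetric.1 hP
  have h1 : HasFDerivAt (fun z => ⟪P z, z⟫_ℝ) _ z := P.hasFDerivAt.inner ℝ (hasFDerivAt_id z)
  have h2 :=
    (hasDerivAt_integral_gain hh b (‖z‖ ^ 2)).comp_hasFDerivAt z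
      (hasStrictFDerivAt_norm_sq z).hasFDerivAt
  have h3 : HasFDerivAt (lyapunovFunction P M h b) _ z := h1.add (h2.const_mul M)
  rw [h3.fderiv]
  simp [hsymm v z, real_inner_comm, Real.sqrt_sq (norm_nonneg z)]
  ring

theorem isClassKInfty_mul_sq {a : ℝ} (ha : 0 < a) : IsClassKInfty fun r => a * r ^ 2 where
  continuousOn := by fun_prop
  strictMonoOn := fun x hx y _ hxy => by
    have hx' : 0 ≤ x := hx
    simp only
    gcongr
  map_zero := by simp
  tendsto := (tendsto_pow_atTop two_ne_zero).const_mul_atTop ha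

theorem IsClassKInfty.add_monotone {ψ g : ℝ → ℝ} (hψ : IsClassKInfty ψ)
    (hg : ContinuousOn g (Ici 0)) (hmono : MonotoneOn g (Ici 0)) (hg0 : g 0 = 0) :
    IsClassKInfty fun r => ψ r + g r where
  continuousOn := hψ.continuousOn.add hg
  strictMonoOn := hψ.strictMonoOn.add_monotone hmono
  map_zero := by simp [hψ.map_zero, hg0]
  tendsto := by
    refine tendsto_atTop_mono' atTop ?_ hψ.tendsto
    filter_upwards [eventually_ge_atTop 0] with r hr
    have := hmono self_mem_Ici hr hr
    linarith

theorem lyapunovFunction_bounds {h : ℝ → ℝ} (hh : IsGain h) {P : H →L[ℝ] H} {M b α : ℝ}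
    (hM : 0 < M) (hα : 0 < α) (hP : ∀ z : H, α * ‖z‖ ^ 2 ≤ ⟪P z, z⟫_ℝ) :
    ∃ ψ₁ ψ₂ : ℝ → ℝ, IsClassKInfty ψ₁ ∧ IsClassKInfty ψ₂ ∧
      ∀ z : H, ψ₁ ‖z‖ ≤ lyapunovFunction P M h b z ∧ lyapunovFunction P M h b z ≤ ψ₂ ‖z‖ := by
  have hmono := monotone_integral_gain hh b
  have hcont := (contDiff_integral_gain hh.continuous b).continuous
  -- The added 1 keeps the coefficient visibly positive, so the quadratic part alone is of class K∞;
  -- the integral part need only be monotone.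
  refine ⟨fun r => α * r ^ 2, fun r => (‖P‖ + 1) * r ^ 2 +
    M * ∫ v in (0 : ℝ)..(r ^ 2), √v * h (b * √v), isClassKInfty_mul_sq hα,
    (isClassKInfty_mul_sq (by positivity)).add_monotone ?_ ?_ (by simp), fun z => ⟨?_, ?_⟩⟩
  · exact (continuous_const.mul (hcont.comp (continuous_pow 2))).continuousOn
  · intro x hx y _ hxy
    have hx' : 0 ≤ x := hx
    have : x ^ 2 ≤ y ^ 2 := by gcongr
    exact mul_le_mul_of_nonneg_left (hmono this) hM.le
  · have h1 : 0 ≤ ∫ v in (0 : ℝ)..(‖z‖ ^ 2), √v * h (b * √v) := by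
      simpa using hmono (sq_nonneg ‖z‖)
    have := mul_nonneg hM.le h1
    rw [lyapunovFunction]
    linarith [hP z]
  · have h1 := real_inner_le_norm (P z) z
    have h2 := P.le_opNorm z
    have h3 : ⟪P z, z⟫_ℝ ≤ ‖P‖ * ‖z‖ * ‖z‖ := h1.trans (by gcongr)
    rw [lyapunovFunction]
    nlinarith [sq_nonneg ‖z‖]

theorem isStrictGlobalLyapunov_of_dissipation {D : Submodule ℝ H} {F : D → H} {V : H → ℝ} {C : ℝ}
    (hV : ContDiff ℝ 1 V)
    (hbounds : ∃ ψ₁ ψ₂ : ℝ → ℝ, IsClassKInfty ψ₁ ∧ IsClassKInfty ψ₂ ∧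
      ∀ z : H, ψ₁ ‖z‖ ≤ V z ∧ V z ≤ ψ₂ ‖z‖)
    (hC : 0 < C) (hdiss : ∀ z : D, fderiv ℝ V (z : H) (F z) ≤ -C * ‖(z : H)‖ ^ 2) :
    IsStrictGlobalLyapunov F V C where
  contDiff := hV
  bounds := hbounds
  rate_pos := hC
  dissipation := hdiss
  along_solutions := fun τ z _ hz => by
    refine ⟨AbsolutelyContinuousOnInterval.contDiff_comp hV hz.absCont, ?_⟩
    filter_upwards [hz.ode] with t ht htτ
    obtain ⟨hmem, hder⟩ := ht htτ
    exact ⟨_, ((hV.differentiable one_ne_zero) (z t)).hasFDerivAt.comp_hasDerivAt t hder,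
      hdiss ⟨z t, hmem⟩⟩

end LyapunovFunction

/-! ### The strict global Lyapunov function for S = U. -/

section Global

variable {H : Type*} [NormedAddCommGroup H] [InnerProductSpace ℝ H] [CompleteSpace H]
  {U : Type*} [NormedAddCommGroup U] [InnerProductSpace ℝ U] [CompleteSpace U]
  {S : Type*} [NormedAddCommGroup S] [NormedSpace ℝ S]
  {A : H →ₗ.[ℝ] H} {B : U →L[ℝ] H} {k : ℝ} {ι : S →L[ℝ] U} {σ : U → S} {C₁ C₂ : ℝ}
  {h : ℝ → ℝ}

/-- A coercive Lyapunov operator for `A - k C₁ B B*`, built from one for `A - k B B*`. -/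
theorem exists_coercive_lyapunov_operator (hA : GeneratesContractionSemigroup A) (hk : 0 < k)
    (hexp : GloballyExpStable (linearClosedLoop A B k)) (hC₁ : 0 < C₁) :
    ∃ P : H →L[ℝ] H, IsSelfAdjoint P ∧ (∃ α > 0, ∀ z : H, α * ‖z‖ ^ 2 ≤ ⟪P z, z⟫_ℝ) ∧
      ∀ z : A.domain, 2 * ⟪P z, linearClosedLoop A B (k * C₁) z⟫_ℝ ≤
        -(1 / 4) * ‖(z : H)‖ ^ 2 := by
  obtain ⟨P₀, hsa, hpos, hlyap⟩ := hexp.exists_lyapunov_operator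
  set N : ℝ := k * |1 - C₁| * (‖P₀‖ * ‖B‖) with hN
  -- Passing from k to kC₁ costs at most N‖z‖‖B*z‖, up to the common factor 2. Young's inequality
  -- splits this into ⅛‖z‖², taken from the strict decay, and 2N²‖B*z‖², absorbed by the
  -- −M₀kC₁‖B*z‖² that the multiple of the identity contributes.
  set M₀ : ℝ := 2 * N ^ 2 / (k * C₁) + 1 with hM₀
  have hM₀pos : 0 < M₀ := by positivity
  have hM₀k : 2 * N ^ 2 ≤ M₀ * (k * C₁) := by
    have h1 : M₀ * (k * C₁) = 2 * N ^ 2 + k * C₁ := by rw [hM₀]; field_simp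
    have h2 : 0 < k * C₁ := by positivity
    linarith
  refine ⟨P₀ + M₀ • ContinuousLinearMap.id ℝ H, ?_, ⟨M₀, hM₀pos, fun z => ?_⟩, fun z => ?_⟩
  · refine hsa.add ?_
    exact (IsSelfAdjoint.all M₀).smul (IsSelfAdjoint.one (H →L[ℝ] H))
  · have h1 := hpos z
    simp only [add_apply, FunLike.coe_smul, Pi.smul_apply,
      ContinuousLinearMap.id_apply, inner_add_left, real_inner_smul_left,
      real_inner_self_eq_norm_sq]
    linarith
  · have h1 : 2 * ⟪P₀ (z : H), linearClosedLoop A B k z⟫_ℝ ≤ -(1 / 2) * ‖(z : H)‖ ^ 2 := hlyap z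
    have h2 := hA.inner_nonpos z
    rw [real_inner_comm] at h2
    set β : U := ContinuousLinearMap.adjoint B (z : H) with hβ
    rw [linearClosedLoop_apply, inner_sub_right, real_inner_smul_right] at h1
    have h3 : ⟪(z : H), B β⟫_ℝ = ‖β‖ ^ 2 := by
      rw [← ContinuousLinearMap.adjoint_inner_left, ← hβ, real_inner_self_eq_norm_sq]
    have h4 : |⟪P₀ (z : H), B β⟫_ℝ| ≤ (‖P₀‖ * ‖B‖) * (‖(z : H)‖ * ‖β‖) := by
      refine (abs_real_inner_le_norm _ _).trans ?_
      calc ‖P₀ (z : H)‖ * ‖B β‖ ≤ (‖P₀‖ * ‖(z : H)‖) * (‖B‖ * ‖β‖) := by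
            gcongr
            · exact P₀.le_opNorm _
            · exact B.le_opNorm _
        _ = _ := by ring
    have h5 : k * ((1 - C₁) * ⟪P₀ (z : H), B β⟫_ℝ) ≤ N * (‖(z : H)‖ * ‖β‖) := by
      calc k * ((1 - C₁) * ⟪P₀ (z : H), B β⟫_ℝ)
          ≤ k * |(1 - C₁) * ⟪P₀ (z : H), B β⟫_ℝ| := by gcongr; exact le_abs_self _
        _ = k * (|1 - C₁| * |⟪P₀ (z : H), B β⟫_ℝ|) := by rw [abs_mul]
        _ ≤ k * (|1 - C₁| * ((‖P₀‖ * ‖B‖) * (‖(z : H)‖ * ‖β‖))) := by gcongr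
        _ = N * (‖(z : H)‖ * ‖β‖) := by rw [hN]; ring
    have h6 : N * (‖(z : H)‖ * ‖β‖) ≤ 1 / 8 * ‖(z : H)‖ ^ 2 + 2 * N ^ 2 * ‖β‖ ^ 2 := by
      nlinarith [sq_nonneg (‖(z : H)‖ - 4 * (N * ‖β‖))]
    have h7 : 2 * N ^ 2 * ‖β‖ ^ 2 ≤ M₀ * (k * C₁) * ‖β‖ ^ 2 := by gcongr
    have h8 : M₀ * ⟪(z : H), A z⟫_ℝ ≤ 0 := mul_nonpos_of_nonneg_of_nonpos hM₀pos.le h2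
    rw [linearClosedLoop_apply, ← hβ]
    simp only [add_apply, FunLike.coe_smul, Pi.smul_apply,
      ContinuousLinearMap.id_apply, inner_add_left, real_inner_smul_left, inner_sub_right,
      real_inner_smul_right, h3]
    linarith

/-- The strict global Lyapunov function in the case `S = U`. -/
theorem exists_strictGlobalLyapunov (hA : GeneratesContractionSemigroup A) (hk : 0 < k)
    (hexp : GloballyExpStable (linearClosedLoop A B k)) (hC₁ : 0 < C₁) (hC₂ : 0 < C₂)
    (hh : IsGain h) (hdamp : DampingInequality ι σ C₁ C₂ h) (hiso : Isometry ι)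
    (hsurj : Function.Surjective ι) :
    ∃ (P : H →L[ℝ] H) (M C : ℝ), IsSelfAdjoint P ∧
      (∃ α > 0, ∀ z : H, α * ‖z‖ ^ 2 ≤ ⟪P z, z⟫_ℝ) ∧
      (∀ z : A.domain,
        ⟪linearClosedLoop A B (k * C₁) z, P z⟫_ℝ + ⟪P z, linearClosedLoop A B (k * C₁) z⟫_ℝ
          ≤ -C * ‖(z : H)‖ ^ 2) ∧
      0 < M ∧
      IsStrictGlobalLyapunov (nonlinearClosedLoop A B k ι σ)
        (lyapunovFunction P M h (√k * ‖B‖)) C := by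
  obtain ⟨P, hsa, ⟨α, hα, hcoer⟩, hlyap⟩ :=
    exists_coercive_lyapunov_operator (B := B) hA hk hexp hC₁
  -- With b = √k‖B‖, the error from the quadratic part is at most 2 b‖P‖C₂ · ‖z‖h(b‖z‖)θ, while the
  -- integral part yields −2M · ‖z‖h(b‖z‖)θ; the added 1 secures M > 0.
  set M : ℝ := √k * ‖B‖ * ‖P‖ * C₂ + 1 with hM
  have hM0 : 0 < M := by positivity
  refine ⟨P, M, 1 / 4, hsa, ⟨α, hα, hcoer⟩, fun z => ?_, hM0,
    isStrictGlobalLyapunov_of_dissipation (contDiff_lyapunovFunction hh.continuous P M _)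
      (lyapunovFunction_bounds hh hM0 hα hcoer) (by norm_num) fun z => ?_⟩
  · rw [real_inner_comm]
    linarith [hlyap z]
  rw [fderiv_lyapunovFunction_apply hh.continuous hsa, nonlinearClosedLoop_eq]
  have hsq : √k * √k = k := Real.mul_self_sqrt hk.le
  set b : ℝ := √k * ‖B‖ with hb
  set s : U := √k • ContinuousLinearMap.adjoint B (z : H) with hs
  have hGP : ⟪P z, dampingTerm B k ι σ z⟫_ℝ =
      -⟪√k • ContinuousLinearMap.adjoint B (P z), ι (σ s)⟫_ℝ := inner_dampingTerm _ _
  have hGz : ⟪(z : H), dampingTerm B k ι σ z⟫_ℝ = -⟪s, ι (σ s)⟫_ℝ := inner_dampingTerm _ _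
  have hBP : ⟪P z, linearClosedLoop A B (k * C₁) z⟫_ℝ =
      ⟪P z, A z⟫_ℝ - C₁ * ⟪√k • ContinuousLinearMap.adjoint B (P z), s⟫_ℝ := by
    rw [linearClosedLoop_apply, inner_sub_right, real_inner_smul_right, hs, real_inner_smul_left,
      real_inner_smul_right, ContinuousLinearMap.adjoint_inner_left]
    linear_combination (-C₁ * ⟪P z, B (ContinuousLinearMap.adjoint B (z : H))⟫_ℝ) * (-hsq)
  have hsn : ‖s‖ ≤ b * ‖(z : H)‖ := by
    rw [hs, norm_smul, Real.norm_of_nonneg (Real.sqrt_nonneg k), hb, mul_assoc]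
    gcongr
    exact norm_adjoint_apply_le B _
  set p : U := √k • ContinuousLinearMap.adjoint B (P z) with hp
  have hpn : ‖p‖ ≤ b * (‖P‖ * ‖(z : H)‖) := by
    rw [hp, norm_smul, Real.norm_of_nonneg (Real.sqrt_nonneg k), hb, mul_assoc]
    gcongr
    refine (norm_adjoint_apply_le B _).trans ?_
    gcongr
    exact P.le_opNorm _
  clear_value p s
  obtain ⟨s₀, rfl⟩ := hsurj s
  have hs₀ : ‖ι s₀‖ = ‖s₀‖ := hiso.norm_map_of_map_zero (map_zero ι) s₀
  set θ : ℝ := ⟪ι (σ (ι s₀)), ι s₀⟫_ℝ with hθ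
  have hθ0 : 0 ≤ θ := hdamp.inner_nonneg hC₂ hh s₀
  -- Here S = U is essential: the S-norm of √k B*z is its U-norm, hence controlled by ‖z‖ without
  -- the graph norm.
  have hhb : h ‖s₀‖ ≤ h (b * ‖(z : H)‖) := hh.mono (hs₀ ▸ hsn)
  have hdual : ‖ι (σ (ι s₀)) - C₁ • ι s₀‖ ≤ C₂ * h (b * ‖(z : H)‖) * θ := by
    refine (norm_le_dualNorm hiso hsurj _).trans ((hdamp s₀).trans ?_)
    gcongr
  have hinner : -⟪p, ι (σ (ι s₀)) - C₁ • ι s₀⟫_ℝ ≤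
      (b * (‖P‖ * ‖(z : H)‖)) * (C₂ * h (b * ‖(z : H)‖) * θ) := by
    refine (neg_le_abs _).trans ((abs_real_inner_le_norm _ _).trans ?_)
    gcongr
  rw [inner_sub_right, real_inner_smul_right] at hinner
  have hAz := hA.inner_nonpos z
  rw [real_inner_comm] at hAz
  have hw : 0 ≤ ‖(z : H)‖ * h (b * ‖(z : H)‖) := mul_nonneg (norm_nonneg _) (hh.nonneg _)
  have hsecond : M * (‖(z : H)‖ * h (b * ‖(z : H)‖)) * (2 * (⟪(z : H), A z⟫_ℝ - θ)) ≤
      (b * ‖P‖ * C₂) * (‖(z : H)‖ * h (b * ‖(z : H)‖)) * (2 * (-θ)) := by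
    have h1 : 0 ≤ M * (‖(z : H)‖ * h (b * ‖(z : H)‖)) := mul_nonneg hM0.le hw
    have h2 := mul_nonpos_of_nonneg_of_nonpos h1 hAz
    have h3 := mul_nonneg hw hθ0
    rw [hM]
    rw [hM] at h2
    linarith
  have hl := hlyap z
  rw [hBP] at hl
  rw [inner_add_right, inner_add_right, hGP, hGz, real_inner_comm (ι (σ (ι s₀))) (ι s₀), ← hθ,
    ← sub_eq_add_neg ⟪(z : H), A z⟫_ℝ θ]
  linarith

end Global

end NonlinearDamping

theorem mainTheorem1
    {H : Type*} [NormedAddCommGroup H] [InnerProductSpace ℝ H] [CompleteSpace H]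
    {U : Type*} [NormedAddCommGroup U] [InnerProductSpace ℝ U] [CompleteSpace U]
    {S : Type*} [NormedAddCommGroup S] [NormedSpace ℝ S] [CompleteSpace S]
    (ι : S →L[ℝ] U) (hι : IsRigging ι)
    (A : H →ₗ.[ℝ] H) (hA : GeneratesContractionSemigroup A)
    (B : U →L[ℝ] H) (k : ℝ) (hk : 0 < k)
    (hexp : GloballyExpStable (linearClosedLoop A B k))
    (σ : U → S) (hσ : LocallyLipschitz (fun u => ι (σ u)))
    (C₁ C₂ : ℝ) (hC₁ : 0 < C₁) (hC₂ : 0 < C₂)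
    (h : ℝ → ℝ) (hh : IsGain h) (hdamp : DampingInequality ι σ C₁ C₂ h) :
    -- the case `S = U`
    (Isometry ι → Function.Surjective ι →
      ∃ (P : H →L[ℝ] H) (M C : ℝ), IsSelfAdjoint P ∧
        (∃ α > 0, ∀ z : H, α * ‖z‖ ^ 2 ≤ ⟪P z, z⟫_ℝ) ∧
        (∀ z : A.domain,
          ⟪linearClosedLoop A B (k * C₁) z, P z⟫_ℝ + ⟪P z, linearClosedLoop A B (k * C₁) z⟫_ℝ
            ≤ -C * ‖(z : H)‖ ^ 2) ∧
        0 < M ∧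
        IsStrictGlobalLyapunov (nonlinearClosedLoop A B k ι σ)
          (lyapunovFunction P M h (√k * ‖B‖)) C) ∧
    -- the general case
    (MonotoneDamping ι σ →
      (∀ R : ℝ, ∃ L : ℝ, ∀ u : U, ‖u‖ ≤ R → ‖ι (σ u)‖ ≤ L) →
      (∃ cS : ℝ, ∀ z : A.domain, ∃ s : S,
        ι s = ContinuousLinearMap.adjoint B (z : H) ∧ ‖s‖ ≤ cS * graphNorm A z) →
      SemiGloballyExpStable A (nonlinearClosedLoop A B k ι σ)) := by
  exact ⟨exists_strictGlobalLyapunov hA hk hexp hC₁ hC₂ hh hdamp,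
    semiGloballyExpStable_of_monotone hι hA hk hexp hσ hC₁ hC₂ hh hdamp⟩
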